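/- Let $\pi:E\to M$ be a smooth fibred manifold (surjective submersion, e.g. a fibre bundle), $\dim M=n$, $\dim E=n+k$, and let $\omega$ be a volume form on $M$. Let $J^1\pi$ be the first jet bundle, i.e. the manifold of linear right inverses $\tau:T_{\pi(e)}M\to T_eE$ of $\pi_*(e)$, with projections $\pi_{1,0}:J^1\pi\to E$ and $\pi_1:J^1\pi\to M$. Let $\lambda:L_\pi E\to E$ be the adapted frame bundle, whose points are the bases $u=(e_1,\dots,e_n,e_{n+1},\dots,e_{n+k})$ of $T_eE$ with $\pi_*(e_A)=0$ for the last $k$ vectors. Below $i,j$ run over the first $n$ indices and $A,B$ over the last $k$. Let $\rho:L_\pi E\to J^1\pi$ send $u$ to the jet $\tau$ with $\tau(\pi_*e_i)=e_i$. The group of invertible block lower triangular matrices acts on $L_\pi E$ on the right, and $E^{*i}_j$, $E^{*A}_B$, $E^{*i}_B$ denote the fundamental vector fields of the elementary matrices, $\xi^*(u)=\frac{d}{dt}\big|_{0}\,u\cdot\exp(t\xi)$; to first order their flows replace $e_i$ by $e_i+te_j$, $e_A$ by $e_A+te_B$ and $e_i$ by $e_i+te_B$, respectively. Let $(\theta^i,\theta^A)$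 be the soldering form, i.e. the components of $\lambda_*X$ in the frame $u$, and let $B_1,\dots,B_n$ be vector fields on $L_\pi E$ with $\lambda_*(B_i(u))=e_i$ (for instance the standard horizontal vector fields of a linear connection). *The form on $J^1\pi$.* For a $1$-form $\alpha$ on $M$ let $S_\alpha(X)=\alpha\odot\omega^1(X)$, where $\omega^1(X)=v-\tau(\pi_*v)$ with $v=(\pi_{1,0})_*X$, and $\alpha\odot\xi$ is the tangent vector at $t=0$ to the curve $\tau+t\,\alpha\otimes\xi$. For a covector $\sigma$ on $J^1\pi$ define $S\sigma$ by $\alpha((S\sigma)(X))=\sigma(S_\alpha(X))$ for all $\alpha$, and define the vector-valued $n$-form $S_\omega$ by $$\sigma(S_\omega(X_1,\dots,X_n))=\sum_{i=1}^n\omega\big((\pi_1)_*X_1,\dots,(S\sigma)(X_i),\dots,(\pi_1)_*X_n\big)\quad\text{for all }\sigma .$$ For $\mathcal L:J^1\pi\to\mathbb R$ put $\Theta_{\mathcal L}=\mathcal L\,\omega+d\mathcal L\circ S_\omega$ (with $\omega$ pulled back to $J^1\pi$), the Cartan–Hamilton–Poincaré $n$-form. *The form on $L_\pi E$.* Let $\tilde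 S_\alpha=\sum_{i,B}\big((\pi\circ\lambda)^*\alpha\big)(B_i)\,E^{*i}_B\otimes\theta^B$, define $\tilde S\sigma$ and $\tilde S_\omega$ from $\tilde S_\alpha$ and $\pi\circ\lambda$ by the same two formulas, and put $\theta_L=L\,\omega+dL\circ\tilde S_\omega$ for $L:L_\pi E\to\mathbb R$ (with $\omega$ pulled back to $L_\pi E$). **Proposition.** Let $L:L_\pi E\to\mathbb R$ be a smooth lifted Lagrangian, that is, $E^{*i}_j(L)=0$ and $E^{*A}_B(L)=0$ for all $i,j,A,B$. 1. If $\mathcal L:J^1\pi\to\mathbb R$ satisfies $\rho^*\mathcal L=L$, then $\mathcal L$ is smooth and $\rho^*\Theta_{\mathcal L}=\theta_L$. 2. If $L$ is constant on the fibres of $\rho$, there is exactly one $\mathcal L$ with $\rho^*\mathcal L=L$. 3. In general, every $u_0\in L_\pi E$ has an open neighbourhood $U$ with $\rho(U)$ open such that there is a smooth function $\mathcal L$ on $\rho(U)$ with $\rho^*\mathcal L=L$ and $\rho^*\Theta_{\mathcal L}=\theta_L$ on $U$. -/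

import Mathlib

open scoped Manifold ContDiff Topology

noncomputable section

namespace FieldTheory

/-- `ℝᵐ` with its standard coordinates. -/
abbrev Rn (m : ℕ) : Type := EuclideanSpace ℝ (Fin m)

instance instFiniteDimensionalTangentSpace {V : Type*} [NormedAddCommGroup V] [NormedSpace ℝ V]
    [FiniteDimensional ℝ V] {X : Type*} [TopologicalSpace X] [ChartedSpace V X] (x : X) :
    FiniteDimensional ℝ (TangentSpace 𝓘(ℝ, V) x) :=
  inferInstanceAs (FiniteDimensional ℝ V)

/-- A smooth fibred manifold `π : E → M` (a surjective submersion) with `dim M = n` and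
`dim E = n + k`. In particular, every smooth fibre bundle is one. -/
structure FiberedManifold (n k : ℕ) (M E : Type*)
    [TopologicalSpace M] [ChartedSpace (Rn n) M] [TopologicalSpace E]
    [ChartedSpace (Rn n × Rn k) E] where
  /-- the projection `π` -/
  proj : E → M
  surjective : Function.Surjective proj
  isSubmersion : Manifold.IsSubmersion 𝓘(ℝ, Rn n × Rn k) 𝓘(ℝ, Rn n) ∞ proj

section

variable {n k : ℕ} {M E : Type*}
  [TopologicalSpace M] [ChartedSpace (Rn n) M] [TopologicalSpace E]
  [ChartedSpace (Rn n × Rn k) E]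

/-- The differential `π_*(e) : T_e E → T_{π(e)} M`. -/
abbrev FiberedManifold.dproj (P : FiberedManifold n k M E) (e : E) :
    TangentSpace 𝓘(ℝ, Rn n × Rn k) e →L[ℝ] TangentSpace 𝓘(ℝ, Rn n) (P.proj e) :=
  mfderiv 𝓘(ℝ, Rn n × Rn k) 𝓘(ℝ, Rn n) P.proj e

/-! ### Adapted coordinates -/

/-- Adapted coordinates: a chart `(xⁱ, yᴬ)` of `E` and a chart `(xⁱ)` of `M` in which the
projection is `(x, y) ↦ x`. -/
structure AdaptedChart (P : FiberedManifold n k M E) where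
  top : OpenPartialHomeomorph E (Rn n × Rn k)
  bot : OpenPartialHomeomorph M (Rn n)
  top_mem : top ∈ IsManifold.maximalAtlas 𝓘(ℝ, Rn n × Rn k) ∞ E
  bot_mem : bot ∈ IsManifold.maximalAtlas 𝓘(ℝ, Rn n) ∞ M
  maps : ∀ e ∈ top.source, P.proj e ∈ bot.source
  comm : ∀ e ∈ top.source, bot (P.proj e) = (top e).1

theorem exists_adaptedChart [IsManifold 𝓘(ℝ, Rn n × Rn k) ∞ E] (P : FiberedManifold n k M E)
    (e : E) : ∃ c : AdaptedChart P, e ∈ c.top.source := by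
  obtain ⟨F, _, _, hF⟩ := P.isSubmersion
  have h := hF e
  set eq := h.equiv
  have hfd : FiniteDimensional ℝ (Rn n × F) := eq.toLinearEquiv.finiteDimensional
  have : FiniteDimensional ℝ F :=
    FiniteDimensional.of_surjective (LinearMap.snd ℝ (Rn n) F) LinearMap.snd_surjective
  have hdim : Module.finrank ℝ F = Module.finrank ℝ (Rn k) := by
    have := eq.toLinearEquiv.finrank_eq
    rw [Module.finrank_prod, Module.finrank_prod] at this
    omega
  let g : F ≃L[ℝ] Rn k := ContinuousLinearEquiv.ofFinrankEq hdim
  let s : (Rn n × Rn k) ≃L[ℝ] (Rn n × Rn k) :=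
    eq.trans ((ContinuousLinearEquiv.refl ℝ (Rn n)).prodCongr g)
  have hs1 : ∀ z, (s z).1 = (eq z).1 := fun z => rfl
  refine ⟨⟨h.domChart.trans s.toHomeomorph.toOpenPartialHomeomorph, h.codChart, ?_,
    h.codChart_mem_maximalAtlas, ?_, ?_⟩, ?_⟩
  · apply OpenPartialHomeomorph.mem_maximalAtlas_of_contMDiffOn
    · have h1 := contMDiffOn_of_mem_maximalAtlas h.domChart_mem_maximalAtlas
      have h2 : ContMDiff 𝓘(ℝ, Rn n × Rn k) 𝓘(ℝ, Rn n × Rn k) ∞ s :=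
        s.contDiff.contMDiff
      simpa using h2.comp_contMDiffOn h1
    · have h1 := contMDiffOn_symm_of_mem_maximalAtlas h.domChart_mem_maximalAtlas
      have h2 : ContMDiff 𝓘(ℝ, Rn n × Rn k) 𝓘(ℝ, Rn n × Rn k) ∞ s.symm :=
        s.symm.contDiff.contMDiff
      refine h1.comp h2.contMDiffOn ?_
      intro z hz
      simpa using hz
  · intro e' he'
    apply h.mapsto_domChart_source_codChart_source
    simpa using he'
  · intro e' he'
    have he'' : e' ∈ h.domChart.source := by simpa using he'
    have hm : h.domChart e' ∈ (h.domChart.extend 𝓘(ℝ, Rn n × Rn k)).target := by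
      simpa using h.domChart.map_source he''
    have := h.writtenInCharts hm
    simpa [he'', hs1] using this
  · simpa using h.mem_domChart_source

/-- The differential of the coordinates `(xⁱ, yᴬ)` at `e`. -/
def AdaptedChart.dtop {P : FiberedManifold n k M E} (c : AdaptedChart P) (e : E) :
    TangentSpace 𝓘(ℝ, Rn n × Rn k) e →L[ℝ] Rn n × Rn k :=
  mfderiv 𝓘(ℝ, Rn n × Rn k) 𝓘(ℝ, Rn n × Rn k) c.top e

/-- The differential of the coordinates `(xⁱ)` at `x`. -/
def AdaptedChart.dbot {P : FiberedManifold n k M E} (c : AdaptedChart P) (x : M) :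
    TangentSpace 𝓘(ℝ, Rn n) x →L[ℝ] Rn n :=
  mfderiv 𝓘(ℝ, Rn n) 𝓘(ℝ, Rn n) c.bot x

section AdaptedChart

variable {P : FiberedManifold n k M E} (c : AdaptedChart P)


theorem AdaptedChart.top_mdifferentiable :
    c.top.MDifferentiable 𝓘(ℝ, Rn n × Rn k) 𝓘(ℝ, Rn n × Rn k) :=
  ⟨(contMDiffOn_of_mem_maximalAtlas c.top_mem).mdifferentiableOn (by simp),
    (contMDiffOn_symm_of_mem_maximalAtlas c.top_mem).mdifferentiableOn (by simp)⟩

theorem AdaptedChart.bot_mdifferentiable : c.bot.MDifferentiable 𝓘(ℝ, Rn n) 𝓘(ℝ, Rn n) :=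
  ⟨(contMDiffOn_of_mem_maximalAtlas c.bot_mem).mdifferentiableOn (by simp),
    (contMDiffOn_symm_of_mem_maximalAtlas c.bot_mem).mdifferentiableOn (by simp)⟩

theorem AdaptedChart.dtop_isInvertible {e : E} (he : e ∈ c.top.source) :
    (c.dtop e).IsInvertible := ⟨c.top_mdifferentiable.mfderiv he, rfl⟩

theorem AdaptedChart.dbot_isInvertible {x : M} (hx : x ∈ c.bot.source) :
    (c.dbot x).IsInvertible := ⟨c.bot_mdifferentiable.mfderiv hx, rfl⟩

theorem FiberedManifold.mdifferentiableAt_proj (P : FiberedManifold n k M E) (e : E) :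
    MDifferentiableAt 𝓘(ℝ, Rn n × Rn k) 𝓘(ℝ, Rn n) P.proj e := by
  obtain ⟨F, _, _, hF⟩ := P.isSubmersion
  exact (hF e).contMDiffAt.mdifferentiableAt (by simp)

theorem AdaptedChart.dbot_dproj {e : E} (he : e ∈ c.top.source)
    (X : TangentSpace 𝓘(ℝ, Rn n × Rn k) e) :
    c.dbot (P.proj e) (P.dproj e X) = (c.dtop e X).1 := by
  have h1 : HasMFDerivAt 𝓘(ℝ, Rn n × Rn k) 𝓘(ℝ, Rn n) (c.bot ∘ P.proj) e
      ((c.dbot (P.proj e)).comp (P.dproj e)) :=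
    (c.bot_mdifferentiable.mdifferentiableAt (c.maps e he)).hasMFDerivAt.comp e
      (P.mdifferentiableAt_proj e).hasMFDerivAt
  have h2 : HasMFDerivAt 𝓘(ℝ, Rn n × Rn k) 𝓘(ℝ, Rn n) (Prod.fst ∘ c.top) e
      ((ContinuousLinearMap.fst ℝ (Rn n) (Rn k)).comp (c.dtop e)) :=
    (ContinuousLinearMap.fst ℝ (Rn n) (Rn k)).hasMFDerivAt.comp e
      (c.top_mdifferentiable.mdifferentiableAt he).hasMFDerivAt
  have h3 : Prod.fst ∘ c.top =ᶠ[𝓝 e] c.bot ∘ P.proj := by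
    filter_upwards [c.top.open_source.mem_nhds he] with e' he'
    exact (c.comm e' he').symm
  have := hasMFDerivAt_unique h1 (h2.congr_of_eventuallyEq h3.symm)
  exact DFunLike.congr_fun this X

/-- Domain of the change of adapted coordinates, in the coordinates of `c`. -/
def AdaptedChart.overlap (c c' : AdaptedChart P) : Set (Rn n × Rn k) :=
  (c.top.symm.trans c'.top).source

theorem AdaptedChart.isOpen_overlap (c c' : AdaptedChart P) : IsOpen (c.overlap c') :=
  (c.top.symm.trans c'.top).open_source

theorem AdaptedChart.contDiffOn_top (c c' : AdaptedChart P) :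
    ContDiffOn ℝ ∞ (c'.top ∘ c.top.symm) (c.overlap c') := by
  rw [← contMDiffOn_iff_contDiffOn]
  refine (contMDiffOn_of_mem_maximalAtlas c'.top_mem).comp
    ((contMDiffOn_symm_of_mem_maximalAtlas c.top_mem).mono ?_) ?_
  · intro z hz
    exact hz.1
  · intro z hz
    exact hz.2

theorem AdaptedChart.contDiffOn_bot (c c' : AdaptedChart P) :
    ContDiffOn ℝ ∞ (c'.bot ∘ c.bot.symm) (c.bot.symm.trans c'.bot).source := by
  rw [← contMDiffOn_iff_contDiffOn]
  refine (contMDiffOn_of_mem_maximalAtlas c'.bot_mem).comp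
    ((contMDiffOn_symm_of_mem_maximalAtlas c.bot_mem).mono ?_) ?_
  · intro z hz
    exact hz.1
  · intro z hz
    exact hz.2

theorem AdaptedChart.dtop_change (c c' : AdaptedChart P) {e : E} (he : e ∈ c.top.source)
    (he' : e ∈ c'.top.source) (X : TangentSpace 𝓘(ℝ, Rn n × Rn k) e) :
    c'.dtop e X = fderiv ℝ (c'.top ∘ c.top.symm) (c.top e) (c.dtop e X) := by
  have hz : c.top e ∈ c.overlap c' := by
    simp [overlap, he, he']
  have h1 := (((c.contDiffOn_top c').contDiffAt
    ((c.isOpen_overlap c').mem_nhds hz)).differentiableAt (by simp)).hasFDerivAt.hasMFDerivAt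
  have h2 := h1.comp e (c.top_mdifferentiable.mdifferentiableAt he).hasMFDerivAt
  have h3 : c'.top =ᶠ[𝓝 e] (c'.top ∘ c.top.symm) ∘ c.top := by
    filter_upwards [c.top.open_source.mem_nhds he] with e' he'
    simp [he']
  have := hasMFDerivAt_unique (c'.top_mdifferentiable.mdifferentiableAt he').hasMFDerivAt
    (h2.congr_of_eventuallyEq h3)
  exact DFunLike.congr_fun this X

theorem AdaptedChart.dbot_change (c c' : AdaptedChart P) {x : M} (hx : x ∈ c.bot.source)
    (hx' : x ∈ c'.bot.source) (X : TangentSpace 𝓘(ℝ, Rn n) x) :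
    c'.dbot x X = fderiv ℝ (c'.bot ∘ c.bot.symm) (c.bot x) (c.dbot x X) := by
  have hz : c.bot x ∈ (c.bot.symm.trans c'.bot).source := by
    simp [hx, hx']
  have h1 := (((c.contDiffOn_bot c').contDiffAt
    ((c.bot.symm.trans c'.bot).open_source.mem_nhds hz)).differentiableAt
      (by simp)).hasFDerivAt.hasMFDerivAt
  have h2 := h1.comp x (c.bot_mdifferentiable.mdifferentiableAt hx).hasMFDerivAt
  have h3 : c'.bot =ᶠ[𝓝 x] (c'.bot ∘ c.bot.symm) ∘ c.bot := by
    filter_upwards [c.bot.open_source.mem_nhds hx] with e' he'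
    simp [he']
  have := hasMFDerivAt_unique (c'.bot_mdifferentiable.mdifferentiableAt hx').hasMFDerivAt
    (h2.congr_of_eventuallyEq h3)
  exact DFunLike.congr_fun this X

end AdaptedChart

/-! ### The jet bundle `J¹π` as a manifold -/

/-- The first jet bundle `J¹π`: pairs of a point `e ∈ E` and a linear right inverse
`τ : T_{π(e)} M → T_e E` of `π_*(e)`. -/
@[ext]
structure Jet (P : FiberedManifold n k M E) where
  base : E
  τ : TangentSpace 𝓘(ℝ, Rn n) (P.proj base) →L[ℝ] TangentSpace 𝓘(ℝ, Rn n × Rn k) base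
  right_inv : ∀ X, P.dproj base (τ X) = X

/-- The space of values of the jet coordinates `((xⁱ, yᴬ), yᴬᵢ)`. -/
abbrev JetModel (n k : ℕ) : Type := (Rn n × Rn k) × (Rn n →L[ℝ] Rn k)

section Jet

variable {P : FiberedManifold n k M E} (c c' : AdaptedChart P)

/-- The jet coordinates `(xⁱ, yᴬ, yᴬᵢ)` induced by adapted coordinates, where
`yᴬᵢ(τ) = dyᴬ(τ(∂/∂xⁱ))`. -/
def AdaptedChart.jetCoord (j : Jet P) : JetModel n k :=
  (c.top j.base, ContinuousLinearMap.snd ℝ (Rn n) (Rn k) ∘L c.dtop j.base ∘L j.τ ∘L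
    (c.dbot (P.proj j.base)).inverse)

theorem AdaptedChart.dtop_jet {j : Jet P} (hj : j.base ∈ c.top.source)
    (X : TangentSpace 𝓘(ℝ, Rn n) (P.proj j.base)) :
    c.dtop j.base (j.τ X) =
      (c.dbot (P.proj j.base) X, (c.jetCoord j).2 (c.dbot (P.proj j.base) X)) := by
  apply Prod.ext
  · rw [← c.dbot_dproj hj, j.right_inv]
  · simp [jetCoord, (c.dbot_isInvertible (c.maps _ hj)).inverse_apply_self]

theorem AdaptedChart.jetCoord_bijOn :
    Set.BijOn c.jetCoord {j | j.base ∈ c.top.source} (c.top.target ×ˢ Set.univ) := by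
  refine ⟨?_, ?_, ?_⟩
  · intro j hj
    exact ⟨c.top.map_source hj, trivial⟩
  · intro j hj j' hj' h
    have hb : j.base = j'.base := c.top.injOn hj hj' (congrArg Prod.fst h)
    have hτ : ∀ X, c.dtop j.base (j.τ X) = _ := fun X => c.dtop_jet hj X
    have hτ' : ∀ X, c.dtop j'.base (j'.τ X) = _ := fun X => c.dtop_jet hj' X
    rw [h] at hτ
    obtain ⟨e, τ, hr⟩ := j
    obtain ⟨e', τ', hr'⟩ := j'
    dsimp only at hb
    subst hb
    congr 1
    ext1 X
    exact (c.dtop_isInvertible hj).injective ((hτ X).trans (hτ' X).symm)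
  · rintro ⟨z, p⟩ ⟨hz, -⟩
    have he : c.top.symm z ∈ c.top.source := c.top.map_target hz
    have hI := c.dtop_isInvertible he
    have hJ := c.dbot_isInvertible (c.maps _ he)
    refine ⟨⟨c.top.symm z, (c.dtop (c.top.symm z)).inverse ∘L
      (ContinuousLinearMap.id ℝ (Rn n)).prod p ∘L c.dbot (P.proj (c.top.symm z)), ?_⟩, he, ?_⟩
    · intro X
      apply hJ.injective
      rw [c.dbot_dproj he]
      simp [hI.self_apply_inverse]
    · apply Prod.ext
      · exact c.top.right_inv hz
      · ext1 w
        simp [jetCoord, hI.self_apply_inverse, hJ.self_apply_inverse]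

/-- The chart of `J¹π` given by jet coordinates (`j₀` only serves to fill in values of the inverse
outside of the domain). -/
def AdaptedChart.jetChart (j₀ : Jet P) : PartialEquiv (Jet P) (JetModel n k) :=
  haveI : Nonempty (Jet P) := ⟨j₀⟩
  Set.BijOn.toPartialEquiv c.jetCoord _ _ c.jetCoord_bijOn

/-- The change of jet coordinates. -/
def AdaptedChart.jetChange (w : JetModel n k) : JetModel n k :=
  ((c'.top ∘ c.top.symm) w.1,
    ContinuousLinearMap.snd ℝ (Rn n) (Rn k) ∘L fderiv ℝ (c'.top ∘ c.top.symm) w.1 ∘L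
      (ContinuousLinearMap.id ℝ (Rn n)).prod w.2 ∘L
      fderiv ℝ (c.bot ∘ c'.bot.symm) ((c'.top ∘ c.top.symm) w.1).1)

theorem AdaptedChart.jetChange_jetCoord {j : Jet P} (hj : j.base ∈ c.top.source)
    (hj' : j.base ∈ c'.top.source) : c.jetChange c' (c.jetCoord j) = c'.jetCoord j := by
  apply Prod.ext
  · simp [jetChange, jetCoord, hj]
  · ext1 w
    have hJ' := c'.dbot_isInvertible (c'.maps _ hj')
    obtain ⟨X, rfl⟩ := hJ'.surjective w
    have h1 := c'.dtop_jet hj' X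
    rw [c.dtop_change c' hj hj', c.dtop_jet hj] at h1
    have h2 := c'.dbot_change c (c'.maps _ hj') (c.maps _ hj) X
    have h3 := congrArg Prod.snd h1
    dsimp only at h3
    rw [← h3, h2]
    simp [jetChange, c'.comm _ hj']
    simp [jetCoord, hj]

theorem AdaptedChart.contDiffOn_jetChange :
    ContDiffOn ℝ ∞ (c.jetChange c') (c.overlap c' ×ˢ Set.univ) := by
  have hfst : Set.MapsTo (Prod.fst : JetModel n k → Rn n × Rn k)
      (c.overlap c' ×ˢ Set.univ) (c.overlap c') := fun w hw => hw.1
  have h1 : ContDiffOn ℝ ∞ (fun w : JetModel n k => (c'.top ∘ c.top.symm) w.1)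
      (c.overlap c' ×ˢ Set.univ) := (c.contDiffOn_top c').comp contDiffOn_fst hfst
  have h2 : ContDiffOn ℝ ∞ (fun w : JetModel n k => fderiv ℝ (c'.top ∘ c.top.symm) w.1)
      (c.overlap c' ×ˢ Set.univ) :=
    ((c.contDiffOn_top c').fderiv_of_isOpen (c.isOpen_overlap c') (by simp)).comp
      contDiffOn_fst hfst
  have h3 : ContDiffOn ℝ ∞ (fun w : JetModel n k =>
      fderiv ℝ (c.bot ∘ c'.bot.symm) ((c'.top ∘ c.top.symm) w.1).1)
      (c.overlap c' ×ˢ Set.univ) := by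
    refine ((c'.contDiffOn_bot c).fderiv_of_isOpen
      (c'.bot.symm.trans c.bot).open_source (by simp)).comp h1.fst ?_
    rintro ⟨z, p⟩ ⟨hz, -⟩
    have he : c.top.symm z ∈ c.top.source := c.top.map_target hz.1
    have he' : c.top.symm z ∈ c'.top.source := hz.2
    have h5 : ((c'.top ∘ c.top.symm) z).1 = c'.bot (P.proj (c.top.symm z)) :=
      (c'.comm _ he').symm
    have h6 := c'.maps _ he'
    have h7 := c.maps _ he
    simp only [h5]
    simp [h6, h7]
  have h4 : ContDiff ℝ ∞ (fun w : JetModel n k =>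
      (ContinuousLinearMap.id ℝ (Rn n)).prod w.2) :=
    (ContinuousLinearMap.prodL (𝕜 := ℝ) (E := Rn n) (F := Rn n) (G := Rn k) ℝ).contDiff.comp
      (contDiff_const.prodMk contDiff_snd)
  exact h1.prodMk (contDiffOn_const.clm_comp (h2.clm_comp (h4.contDiffOn.clm_comp h3)))

theorem AdaptedChart.jetChart_trans_source (j₀ j₀' : Jet P) :
    ((c.jetChart j₀).symm.trans (c'.jetChart j₀')).source = c.overlap c' ×ˢ Set.univ := by
  ext w
  constructor
  · rintro ⟨hw, hw'⟩
    have h1 : ((c.jetChart j₀).symm w).base ∈ c.top.source := (c.jetChart j₀).map_target hw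
    have h2 : c.jetCoord ((c.jetChart j₀).symm w) = w := (c.jetChart j₀).right_inv hw
    have h3 : ((c.jetChart j₀).symm w).base ∈ c'.top.source := hw'
    have h4 : c.top ((c.jetChart j₀).symm w).base = w.1 := congrArg Prod.fst h2
    refine ⟨⟨hw.1, ?_⟩, trivial⟩
    change c.top.symm w.1 ∈ c'.top.source
    rwa [← h4, c.top.left_inv h1]
  · rintro ⟨⟨hw, hw'⟩, -⟩
    have hw0 : w ∈ (c.jetChart j₀).target := ⟨hw, trivial⟩
    have h1 : ((c.jetChart j₀).symm w).base ∈ c.top.source := (c.jetChart j₀).map_target hw0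
    have h2 : c.jetCoord ((c.jetChart j₀).symm w) = w := (c.jetChart j₀).right_inv hw0
    have h4 : c.top ((c.jetChart j₀).symm w).base = w.1 := congrArg Prod.fst h2
    refine ⟨hw0, ?_⟩
    change ((c.jetChart j₀).symm w).base ∈ c'.top.source
    change c.top.symm w.1 ∈ c'.top.source at hw'
    rwa [← h4, c.top.left_inv h1] at hw'

theorem AdaptedChart.jetChart_trans_eqOn (j₀ j₀' : Jet P) :
    Set.EqOn ((c.jetChart j₀).symm.trans (c'.jetChart j₀')) (c.jetChange c')
      (c.overlap c' ×ˢ Set.univ) := by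
  intro w hw
  rw [← c.jetChart_trans_source c' j₀ j₀'] at hw
  have h1 : ((c.jetChart j₀).symm w).base ∈ c.top.source := (c.jetChart j₀).map_target hw.1
  have h2 : c.jetCoord ((c.jetChart j₀).symm w) = w := (c.jetChart j₀).right_inv hw.1
  have h3 := c.jetChange_jetCoord c' h1 hw.2
  rw [h2] at h3
  exact h3.symm

variable [IsManifold 𝓘(ℝ, Rn n × Rn k) ∞ E]

/-- An adapted chart around a point of `E`. -/
def adaptedChartAt (P : FiberedManifold n k M E) (e : E) : AdaptedChart P :=
  (exists_adaptedChart P e).choose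

theorem mem_adaptedChartAt (P : FiberedManifold n k M E) (e : E) :
    e ∈ (adaptedChartAt P e).top.source :=
  (exists_adaptedChart P e).choose_spec

/-- The atlas of `J¹π` consisting of all jet coordinate charts. -/
def jetCore (P : FiberedManifold n k M E) : ChartedSpaceCore (JetModel n k) (Jet P) where
  atlas := {φ | ∃ (c : AdaptedChart P) (j₀ : Jet P), φ = c.jetChart j₀}
  chartAt j := (adaptedChartAt P j.base).jetChart j
  mem_chart_source j := mem_adaptedChartAt P j.base
  chart_mem_atlas j := ⟨_, _, rfl⟩
  open_source := by
    rintro _ _ ⟨c, j₀, rfl⟩ ⟨c', j₀', rfl⟩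
    rw [c.jetChart_trans_source c' j₀ j₀']
    exact (c.isOpen_overlap c').prod isOpen_univ
  continuousOn_toFun := by
    rintro _ _ ⟨c, j₀, rfl⟩ ⟨c', j₀', rfl⟩
    rw [c.jetChart_trans_source c' j₀ j₀']
    exact (c.contDiffOn_jetChange c').continuousOn.congr (c.jetChart_trans_eqOn c' j₀ j₀')

instance instTopologicalSpaceJet : TopologicalSpace (Jet P) := (jetCore P).toTopologicalSpace

instance instChartedSpaceJet : ChartedSpace (JetModel n k) (Jet P) := (jetCore P).toChartedSpace

instance instIsManifoldJet : IsManifold 𝓘(ℝ, JetModel n k) ∞ (Jet P) := by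
  apply isManifold_of_contDiffOn
  intro f f' hf hf'
  obtain ⟨_, ⟨_, rfl⟩, hf⟩ := hf
  obtain ⟨_, ⟨⟨c, j₀, rfl⟩, rfl⟩, rfl⟩ := hf
  obtain ⟨_, ⟨_, rfl⟩, hf'⟩ := hf'
  obtain ⟨_, ⟨⟨c', j₀', rfl⟩, rfl⟩, rfl⟩ := hf'
  have h := (c.contDiffOn_jetChange c').congr (c.jetChart_trans_eqOn c' j₀ j₀')
  rw [← c.jetChart_trans_source c' j₀ j₀'] at h
  refine h.mono ?_
  intro w hw
  exact hw.1

end Jet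

/-! ### The adapted frame bundle `L_π E` as a manifold -/

/-- The adapted frame bundle `L_π E`: an adapted frame at `e ∈ E`, written as the linear
isomorphism `ℝⁿ × ℝᵏ → T_e E` sending the standard basis to the frame `(e_i, e_A)`; the last `k`
basis vectors are vertical. -/
@[ext]
structure AdaptedFrame (P : FiberedManifold n k M E) where
  base : E
  toMap : (Rn n × Rn k) →L[ℝ] TangentSpace 𝓘(ℝ, Rn n × Rn k) base
  bijective : Function.Bijective toMap
  vertical : ∀ y : Rn k, P.dproj base (toMap (0, y)) = 0

/-- The space of values of the frame coordinates `((xⁱ, yᴬ), vⁱⱼ, vᴬⱼ, vᴬ_B)`. -/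
abbrev FrameModel (n k : ℕ) : Type :=
  (Rn n × Rn k) × ((Rn n →L[ℝ] Rn n) × (Rn n →L[ℝ] Rn k) × (Rn k →L[ℝ] Rn k))

/-- The block lower triangular map with the given blocks. -/
def lowerBlock {n k : ℕ} (v : (Rn n →L[ℝ] Rn n) × (Rn n →L[ℝ] Rn k) × (Rn k →L[ℝ] Rn k)) :
    (Rn n × Rn k) →L[ℝ] Rn n × Rn k :=
  (v.1.prod v.2.1) ∘L ContinuousLinearMap.fst ℝ (Rn n) (Rn k) +
    (ContinuousLinearMap.inr ℝ (Rn n) (Rn k) ∘L v.2.2) ∘L ContinuousLinearMap.snd ℝ (Rn n) (Rn k)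

@[simp]
theorem lowerBlock_apply {n k : ℕ}
    (v : (Rn n →L[ℝ] Rn n) × (Rn n →L[ℝ] Rn k) × (Rn k →L[ℝ] Rn k)) (x : Rn n) (y : Rn k) :
    lowerBlock v (x, y) = (v.1 x, v.2.1 x + v.2.2 y) := by
  simp [lowerBlock]

theorem isUnit_iff_bijective {V : Type*} [NormedAddCommGroup V] [NormedSpace ℝ V]
    [FiniteDimensional ℝ V] (f : V →L[ℝ] V) : IsUnit f ↔ Function.Bijective f := by
  have : CompleteSpace V := FiniteDimensional.complete ℝ V
  exact ContinuousLinearMap.isUnit_iff_bijective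

theorem lowerBlock_bijective_iff {n k : ℕ}
    (v : (Rn n →L[ℝ] Rn n) × (Rn n →L[ℝ] Rn k) × (Rn k →L[ℝ] Rn k)) :
    Function.Bijective (lowerBlock v) ↔ IsUnit v.1 ∧ IsUnit v.2.2 := by
  rw [isUnit_iff_bijective, isUnit_iff_bijective]
  constructor
  · intro h
    constructor
    · have hs : Function.Surjective v.1 := by
        intro x
        obtain ⟨⟨x', y'⟩, h'⟩ := h.2 (x, 0)
        rw [lowerBlock_apply] at h'
        exact ⟨x', congrArg Prod.fst h'⟩
      exact ⟨(LinearMap.injective_iff_surjective (f := v.1.toLinearMap)).2 hs, hs⟩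
    · have hi : Function.Injective v.2.2 := by
        intro y y' hy
        have : lowerBlock v (0, y) = lowerBlock v (0, y') := by simp [hy]
        exact congrArg Prod.snd (h.1 this)
      exact ⟨hi, (LinearMap.injective_iff_surjective (f := v.2.2.toLinearMap)).1 hi⟩
  · rintro ⟨ha, hb⟩
    constructor
    · rintro ⟨x, y⟩ ⟨x', y'⟩ h
      rw [lowerBlock_apply, lowerBlock_apply] at h
      have h1 : x = x' := ha.1 (congrArg Prod.fst h)
      subst h1
      have h2 := congrArg Prod.snd h
      simp only [add_right_inj] at h2
      rw [hb.1 h2]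
    · rintro ⟨x, y⟩
      obtain ⟨x', rfl⟩ := ha.2 x
      obtain ⟨y', hy'⟩ := hb.2 (y - v.2.1 x')
      exact ⟨(x', y'), by simp [hy']⟩

section Frame

variable {P : FiberedManifold n k M E} (c c' : AdaptedChart P)

/-- The blocks of a linear endomorphism of `ℝⁿ × ℝᵏ` other than the upper right one. -/
def blocks {n k : ℕ} (w : (Rn n × Rn k) →L[ℝ] Rn n × Rn k) :
    (Rn n →L[ℝ] Rn n) × (Rn n →L[ℝ] Rn k) × (Rn k →L[ℝ] Rn k) :=
  (ContinuousLinearMap.fst ℝ (Rn n) (Rn k) ∘L w ∘L ContinuousLinearMap.inl ℝ (Rn n) (Rn k),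
    ContinuousLinearMap.snd ℝ (Rn n) (Rn k) ∘L w ∘L ContinuousLinearMap.inl ℝ (Rn n) (Rn k),
    ContinuousLinearMap.snd ℝ (Rn n) (Rn k) ∘L w ∘L ContinuousLinearMap.inr ℝ (Rn n) (Rn k))

theorem blocks_lowerBlock {n k : ℕ}
    (v : (Rn n →L[ℝ] Rn n) × (Rn n →L[ℝ] Rn k) × (Rn k →L[ℝ] Rn k)) :
    blocks (lowerBlock v) = v := by
  refine Prod.ext ?_ (Prod.ext ?_ ?_) <;> ext1 <;> simp [blocks]

theorem lowerBlock_blocks {n k : ℕ} (w : (Rn n × Rn k) →L[ℝ] Rn n × Rn k)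
    (hw : ∀ y, (w (0, y)).1 = 0) : lowerBlock (blocks w) = w := by
  refine ContinuousLinearMap.ext fun ⟨x, y⟩ => ?_
  have h : w (x, y) = w (x, 0) + w (0, y) := by simp [← map_add]
  rw [h]
  apply Prod.ext <;> simp [blocks, hw]

/-- The frame coordinates `(xⁱ, yᴬ, vⁱⱼ, vᴬⱼ, vᴬ_B)` induced by adapted coordinates. -/
def AdaptedChart.frameCoord (u : AdaptedFrame P) : FrameModel n k :=
  (c.top u.base, blocks (c.dtop u.base ∘L u.toMap))

theorem AdaptedChart.lowerBlock_frameCoord {u : AdaptedFrame P} (hu : u.base ∈ c.top.source) :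
    lowerBlock (c.frameCoord u).2 = c.dtop u.base ∘L u.toMap := by
  apply lowerBlock_blocks
  intro y
  simp [← c.dbot_dproj hu, u.vertical]

/-- The values of the frame coordinates. -/
def frameUnits (n k : ℕ) :
    Set ((Rn n →L[ℝ] Rn n) × (Rn n →L[ℝ] Rn k) × (Rn k →L[ℝ] Rn k)) :=
  {v | IsUnit v.1 ∧ IsUnit v.2.2}

theorem isOpen_frameUnits (n k : ℕ) : IsOpen (frameUnits n k) :=
  (Units.isOpen.preimage continuous_fst).inter
    (Units.isOpen.preimage (continuous_snd.comp continuous_snd))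

theorem AdaptedChart.frameCoord_bijOn :
    Set.BijOn c.frameCoord {u | u.base ∈ c.top.source} (c.top.target ×ˢ frameUnits n k) := by
  refine ⟨?_, ?_, ?_⟩
  · intro u hu
    refine ⟨c.top.map_source hu, ?_⟩
    change IsUnit _ ∧ IsUnit _
    rw [← lowerBlock_bijective_iff, c.lowerBlock_frameCoord hu]
    exact (c.dtop_isInvertible hu).bijective.comp u.bijective
  · intro u hu u' hu' h
    have hb : u.base = u'.base := c.top.injOn hu hu' (congrArg Prod.fst h)
    have h1 := c.lowerBlock_frameCoord hu
    have h2 := c.lowerBlock_frameCoord hu'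
    rw [h] at h1
    obtain ⟨e, f, hr, hv⟩ := u
    obtain ⟨e', f', hr', hv'⟩ := u'
    dsimp only at hb
    subst hb
    congr 1
    refine ContinuousLinearMap.ext fun X => ?_
    exact (c.dtop_isInvertible hu).injective (DFunLike.congr_fun (h1.symm.trans h2) X)
  · rintro ⟨z, v⟩ ⟨hz, hv⟩
    have he : c.top.symm z ∈ c.top.source := c.top.map_target hz
    have hI := c.dtop_isInvertible he
    have hJ := c.dbot_isInvertible (c.maps _ he)
    refine ⟨⟨c.top.symm z, (c.dtop (c.top.symm z)).inverse ∘L lowerBlock v, ?_, ?_⟩, he, ?_⟩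
    · exact hI.inverse.bijective.comp ((lowerBlock_bijective_iff v).2 hv)
    · intro y
      apply hJ.injective
      rw [c.dbot_dproj he]
      simp [hI.self_apply_inverse]
    · apply Prod.ext
      · exact c.top.right_inv hz
      · change blocks (_ ∘L (_ ∘L _)) = v
        rw [← ContinuousLinearMap.comp_assoc, hI.self_comp_inverse]
        exact blocks_lowerBlock v

/-- The chart of `L_π E` given by frame coordinates (`u₀` only serves to fill in values of the
inverse outside of the domain). -/
def AdaptedChart.frameChart (u₀ : AdaptedFrame P) :
    PartialEquiv (AdaptedFrame P) (FrameModel n k) :=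
  haveI : Nonempty (AdaptedFrame P) := ⟨u₀⟩
  Set.BijOn.toPartialEquiv c.frameCoord _ _ c.frameCoord_bijOn

/-- The change of frame coordinates. -/
def AdaptedChart.frameChange (w : FrameModel n k) : FrameModel n k :=
  ((c'.top ∘ c.top.symm) w.1, blocks (fderiv ℝ (c'.top ∘ c.top.symm) w.1 ∘L lowerBlock w.2))

theorem AdaptedChart.frameChange_frameCoord {u : AdaptedFrame P} (hu : u.base ∈ c.top.source)
    (hu' : u.base ∈ c'.top.source) : c.frameChange c' (c.frameCoord u) = c'.frameCoord u := by
  apply Prod.ext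
  · simp [frameChange, frameCoord, hu]
  · change blocks _ = blocks _
    congr 1
    rw [c.lowerBlock_frameCoord hu]
    refine ContinuousLinearMap.ext fun w => ?_
    exact (c.dtop_change c' hu hu' (u.toMap w)).symm

theorem AdaptedChart.contDiffOn_frameChange :
    ContDiffOn ℝ ∞ (c.frameChange c') (c.overlap c' ×ˢ frameUnits n k) := by
  have hfst : Set.MapsTo (Prod.fst : FrameModel n k → Rn n × Rn k)
      (c.overlap c' ×ˢ frameUnits n k) (c.overlap c') := fun w hw => hw.1
  have h1 : ContDiffOn ℝ ∞ (fun w : FrameModel n k => (c'.top ∘ c.top.symm) w.1)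
      (c.overlap c' ×ˢ frameUnits n k) := (c.contDiffOn_top c').comp contDiffOn_fst hfst
  have h2 : ContDiffOn ℝ ∞ (fun w : FrameModel n k => fderiv ℝ (c'.top ∘ c.top.symm) w.1)
      (c.overlap c' ×ˢ frameUnits n k) :=
    ((c.contDiffOn_top c').fderiv_of_isOpen (c.isOpen_overlap c') (by simp)).comp
      contDiffOn_fst hfst
  have h0 : ContDiff ℝ ∞ (fun w : FrameModel n k => w.2.1.prod w.2.2.1) :=
    (ContinuousLinearMap.prodL (𝕜 := ℝ) (E := Rn n) (F := Rn n) (G := Rn k) ℝ).contDiff.comp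
      ((contDiff_fst.comp contDiff_snd).prodMk
        (contDiff_fst.comp (contDiff_snd.comp contDiff_snd)))
  have h0' : ContDiff ℝ ∞ (fun w : FrameModel n k => w.2.2.2) :=
    contDiff_snd.comp (contDiff_snd.comp contDiff_snd)
  have h3 : ContDiff ℝ ∞ (fun w : FrameModel n k => lowerBlock w.2) :=
    (h0.clm_comp contDiff_const).add
      ((contDiff_const.clm_comp h0').clm_comp contDiff_const)
  have h4 := h2.clm_comp h3.contDiffOn
  exact h1.prodMk ((contDiffOn_const.clm_comp (h4.clm_comp contDiffOn_const)).prodMk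
    ((contDiffOn_const.clm_comp (h4.clm_comp contDiffOn_const)).prodMk
      (contDiffOn_const.clm_comp (h4.clm_comp contDiffOn_const))))

theorem AdaptedChart.frameChart_trans_source (u₀ u₀' : AdaptedFrame P) :
    ((c.frameChart u₀).symm.trans (c'.frameChart u₀')).source =
      c.overlap c' ×ˢ frameUnits n k := by
  ext w
  constructor
  · rintro ⟨hw, hw'⟩
    have h1 : ((c.frameChart u₀).symm w).base ∈ c.top.source := (c.frameChart u₀).map_target hw
    have h2 : c.frameCoord ((c.frameChart u₀).symm w) = w := (c.frameChart u₀).right_inv hw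
    have h3 : ((c.frameChart u₀).symm w).base ∈ c'.top.source := hw'
    have h4 : c.top ((c.frameChart u₀).symm w).base = w.1 := congrArg Prod.fst h2
    refine ⟨⟨hw.1, ?_⟩, hw.2⟩
    change c.top.symm w.1 ∈ c'.top.source
    rwa [← h4, c.top.left_inv h1]
  · rintro ⟨⟨hw, hw'⟩, hv⟩
    have hw0 : w ∈ (c.frameChart u₀).target := ⟨hw, hv⟩
    have h1 : ((c.frameChart u₀).symm w).base ∈ c.top.source := (c.frameChart u₀).map_target hw0
    have h2 : c.frameCoord ((c.frameChart u₀).symm w) = w := (c.frameChart u₀).right_inv hw0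
    have h4 : c.top ((c.frameChart u₀).symm w).base = w.1 := congrArg Prod.fst h2
    refine ⟨hw0, ?_⟩
    change ((c.frameChart u₀).symm w).base ∈ c'.top.source
    change c.top.symm w.1 ∈ c'.top.source at hw'
    rwa [← h4, c.top.left_inv h1] at hw'

theorem AdaptedChart.frameChart_trans_eqOn (u₀ u₀' : AdaptedFrame P) :
    Set.EqOn ((c.frameChart u₀).symm.trans (c'.frameChart u₀')) (c.frameChange c')
      (c.overlap c' ×ˢ frameUnits n k) := by
  intro w hw
  rw [← c.frameChart_trans_source c' u₀ u₀'] at hw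
  have h1 : ((c.frameChart u₀).symm w).base ∈ c.top.source := (c.frameChart u₀).map_target hw.1
  have h2 : c.frameCoord ((c.frameChart u₀).symm w) = w := (c.frameChart u₀).right_inv hw.1
  have h3 := c.frameChange_frameCoord c' h1 hw.2
  rw [h2] at h3
  exact h3.symm

variable [IsManifold 𝓘(ℝ, Rn n × Rn k) ∞ E]

/-- The atlas of `L_π E` consisting of all frame coordinate charts. -/
def frameCore (P : FiberedManifold n k M E) :
    ChartedSpaceCore (FrameModel n k) (AdaptedFrame P) where
  atlas := {φ | ∃ (c : AdaptedChart P) (u₀ : AdaptedFrame P), φ = c.frameChart u₀}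
  chartAt u := (adaptedChartAt P u.base).frameChart u
  mem_chart_source u := mem_adaptedChartAt P u.base
  chart_mem_atlas u := ⟨_, _, rfl⟩
  open_source := by
    rintro _ _ ⟨c, u₀, rfl⟩ ⟨c', u₀', rfl⟩
    rw [c.frameChart_trans_source c' u₀ u₀']
    exact (c.isOpen_overlap c').prod (isOpen_frameUnits n k)
  continuousOn_toFun := by
    rintro _ _ ⟨c, u₀, rfl⟩ ⟨c', u₀', rfl⟩
    rw [c.frameChart_trans_source c' u₀ u₀']
    exact (c.contDiffOn_frameChange c').continuousOn.congr (c.frameChart_trans_eqOn c' u₀ u₀')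

instance instTopologicalSpaceFrame : TopologicalSpace (AdaptedFrame P) :=
  (frameCore P).toTopologicalSpace

instance instChartedSpaceFrame : ChartedSpace (FrameModel n k) (AdaptedFrame P) :=
  (frameCore P).toChartedSpace

instance instIsManifoldFrame : IsManifold 𝓘(ℝ, FrameModel n k) ∞ (AdaptedFrame P) := by
  apply isManifold_of_contDiffOn
  intro f f' hf hf'
  obtain ⟨_, ⟨_, rfl⟩, hf⟩ := hf
  obtain ⟨_, ⟨⟨c, u₀, rfl⟩, rfl⟩, rfl⟩ := hf
  obtain ⟨_, ⟨_, rfl⟩, hf'⟩ := hf'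
  obtain ⟨_, ⟨⟨c', u₀', rfl⟩, rfl⟩, rfl⟩ := hf'
  have h := (c.contDiffOn_frameChange c').congr (c.frameChart_trans_eqOn c' u₀ u₀')
  rw [← c.frameChart_trans_source c' u₀ u₀'] at h
  refine h.mono ?_
  intro w hw
  exact hw.1

end Frame

/-! ### Pointwise linear algebra of the tensors `S_ω` -/

section LinearAlgebra

variable {V T : Type*} [AddCommGroup V] [Module ℝ V]
  [AddCommGroup T] [Module ℝ T] [FiniteDimensional ℝ T]

/-- Given endomorphisms `S_α` of `V` depending linearly on the covector `α` of `T`, and a vector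
`X` of `V`: the map taking a covector `σ` of `V` to the unique vector `(Sσ)(X)` of `T` such that
`α((Sσ)(X)) = σ(S_α(X))` for all `α`. -/
def alongForm (S : Module.Dual ℝ T →ₗ[ℝ] V → V) (X : V) : Module.Dual ℝ V →ₗ[ℝ] T :=
  (Module.evalEquiv ℝ T).symm.toLinearMap ∘ₗ
    { toFun := fun σ => σ ∘ₗ (LinearMap.proj X : (V → V) →ₗ[ℝ] V) ∘ₗ S
      map_add' := fun _ _ => rfl
      map_smul' := fun _ _ => rfl }

theorem apply_alongForm (S : Module.Dual ℝ T →ₗ[ℝ] V → V) (X : V) (σ : Module.Dual ℝ V)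
    (α : Module.Dual ℝ T) : α (alongForm S X σ) = σ (S α X) := by
  simp only [alongForm, LinearMap.comp_apply, LinearEquiv.coe_coe,
    Module.apply_evalEquiv_symm_apply]
  rfl

variable [FiniteDimensional ℝ V]

/-- The tensor `S_ω`: the unique vector `S_ω(X₁, …, Xₙ)` of `V` such that for all `σ`
`σ(S_ω(X₁, …, Xₙ)) = ∑ᵢ ω(p X₁, …, (Sσ)(Xᵢ), …, p Xₙ)`, with `(Sσ)(Xᵢ)` at the `i`-th place. -/
def volumeTensor {n : ℕ} (p : V →ₗ[ℝ] T) (S : Module.Dual ℝ T →ₗ[ℝ] V → V)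
    (vol : T [⋀^Fin n]→ₗ[ℝ] ℝ) (X : Fin n → V) : V :=
  (Module.evalEquiv ℝ V).symm
    (∑ i, vol.toMultilinearMap.toLinearMap (fun l => p (X l)) i ∘ₗ alongForm S (X i))

theorem apply_volumeTensor {n : ℕ} (p : V →ₗ[ℝ] T) (S : Module.Dual ℝ T →ₗ[ℝ] V → V)
    (vol : T [⋀^Fin n]→ₗ[ℝ] ℝ) (X : Fin n → V) (σ : Module.Dual ℝ V) :
    σ (volumeTensor p S vol X) =
      ∑ i, vol (Function.update (fun l => p (X l)) i (alongForm S (X i) σ)) := by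
  simp [volumeTensor, Module.apply_evalEquiv_symm_apply]

end LinearAlgebra

section Geometry

variable [IsManifold 𝓘(ℝ, Rn n × Rn k) ∞ E] {P : FiberedManifold n k M E}

/-- Covectors at `x ∈ M`, in the preferred chart; this only serves to differentiate with respect to
a covector. -/
def cotangentCoord (x : M) :
    Module.Dual ℝ (TangentSpace 𝓘(ℝ, Rn n) x) ≃ₗ[ℝ] (Rn n →L[ℝ] ℝ) :=
  (LinearMap.toContinuousLinearMap : (Rn n →ₗ[ℝ] ℝ) ≃ₗ[ℝ] (Rn n →L[ℝ] ℝ))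

/-! ### The Cartan–Hamilton–Poincaré form on `J¹π` -/

/-- The projection `π₁ : J¹π → M`. -/
abbrev Jet.proj (j : Jet P) : M := P.proj j.base

/-- `(π₁,₀)_*`, where `π₁,₀ : J¹π → E`. -/
def Jet.dbase (j : Jet P) :
    TangentSpace 𝓘(ℝ, JetModel n k) j →L[ℝ] TangentSpace 𝓘(ℝ, Rn n × Rn k) j.base :=
  mfderiv 𝓘(ℝ, JetModel n k) 𝓘(ℝ, Rn n × Rn k) (Jet.base : Jet P → E) j

/-- `(π₁)_*`. -/
def Jet.dproj (j : Jet P) :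
    TangentSpace 𝓘(ℝ, JetModel n k) j →L[ℝ] TangentSpace 𝓘(ℝ, Rn n) j.proj :=
  mfderiv 𝓘(ℝ, JetModel n k) 𝓘(ℝ, Rn n) (Jet.proj : Jet P → M) j

/-- The canonical contact form `ω¹`: `X ↦ v - τ(π_* v)` with `v = (π₁,₀)_* X`. -/
def Jet.contactForm (j : Jet P) :
    TangentSpace 𝓘(ℝ, JetModel n k) j →L[ℝ] TangentSpace 𝓘(ℝ, Rn n × Rn k) j.base :=
  j.dbase - j.τ ∘L P.dproj j.base ∘L j.dbase

theorem Jet.dproj_contactForm (j : Jet P) (X : TangentSpace 𝓘(ℝ, JetModel n k) j) :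
    P.dproj j.base (j.contactForm X) = 0 := by
  simp [contactForm, j.right_inv]

/-- The jet `τ + η ⊗ ξ`, where `η ∈ T*_{π(e)} M` and `ξ ∈ T_e E` is vertical. -/
def Jet.translate (j : Jet P) (ξ : TangentSpace 𝓘(ℝ, Rn n × Rn k) j.base)
    (hξ : P.dproj j.base ξ = 0) (η : TangentSpace 𝓘(ℝ, Rn n) j.proj →L[ℝ] ℝ) : Jet P where
  base := j.base
  τ := j.τ + η.smulRight ξ
  right_inv X := by
    have h := j.right_inv X
    simp [h, hξ]

theorem Jet.translate_zero (j : Jet P) (ξ : TangentSpace 𝓘(ℝ, Rn n × Rn k) j.base)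
    (hξ : P.dproj j.base ξ = 0) : j.translate ξ hξ 0 = j := by
  cases j
  simp [translate]

/-- The vertical lift `η ⊙ ξ` of a vertical vector `ξ`, as a function of `η`: the derivative at `0`
of the affine map `η ↦ τ + η ⊗ ξ`, which takes the value `τ` at `η = 0` by `Jet.translate_zero`. In
jet coordinates it is `ηᵢ ξᴬ ∂/∂yᴬᵢ`. -/
def Jet.verticalLift (j : Jet P) (ξ : TangentSpace 𝓘(ℝ, Rn n × Rn k) j.base)
    (hξ : P.dproj j.base ξ = 0) :
    (Rn n →L[ℝ] ℝ) →L[ℝ] TangentSpace 𝓘(ℝ, JetModel n k) j :=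
  mfderiv 𝓘(ℝ, Rn n →L[ℝ] ℝ) 𝓘(ℝ, JetModel n k)
    (fun η : Rn n →L[ℝ] ℝ => j.translate ξ hξ η) 0

/-- The vector-valued `1`-forms `S_α : X ↦ α ⊙ ω¹(X)` on `J¹π`. -/
def Jet.S (j : Jet P) : Module.Dual ℝ (TangentSpace 𝓘(ℝ, Rn n) j.proj) →ₗ[ℝ]
    TangentSpace 𝓘(ℝ, JetModel n k) j → TangentSpace 𝓘(ℝ, JetModel n k) j where
  toFun α X := j.verticalLift (j.contactForm X) (j.dproj_contactForm X) (cotangentCoord j.proj α)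
  map_add' α β := by
    ext X
    simp
  map_smul' a α := by
    ext X
    simp

/-- The vector-valued `n`-form `S_ω` on `J¹π`. -/
def Jet.Somega (vol : ∀ x : M, TangentSpace 𝓘(ℝ, Rn n) x [⋀^Fin n]→ₗ[ℝ] ℝ) (j : Jet P)
    (X : Fin n → TangentSpace 𝓘(ℝ, JetModel n k) j) : TangentSpace 𝓘(ℝ, JetModel n k) j :=
  volumeTensor j.dproj.toLinearMap j.S (vol j.proj) X

/-- The differential `dℒ` of a function on `J¹π`. -/
def Jet.d (ℒ : Jet P → ℝ) (j : Jet P) : TangentSpace 𝓘(ℝ, JetModel n k) j →L[ℝ] ℝ :=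
  mfderiv 𝓘(ℝ, JetModel n k) 𝓘(ℝ, ℝ) ℒ j

/-- The Cartan–Hamilton–Poincaré `n`-form `Θ_ℒ = ℒ ω + dℒ ∘ S_ω` on `J¹π`. -/
def chpForm (vol : ∀ x : M, TangentSpace 𝓘(ℝ, Rn n) x [⋀^Fin n]→ₗ[ℝ] ℝ) (ℒ : Jet P → ℝ)
    (j : Jet P) (X : Fin n → TangentSpace 𝓘(ℝ, JetModel n k) j) : ℝ :=
  ℒ j * vol j.proj (fun i => j.dproj (X i)) + Jet.d ℒ j (j.Somega vol X)

/-! ### The projection `ρ : L_π E → J¹π` -/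

theorem FiberedManifold.dproj_surjective (P : FiberedManifold n k M E) (e : E) :
    Function.Surjective (P.dproj e) := by
  intro X
  obtain ⟨c, he⟩ := exists_adaptedChart P e
  obtain ⟨Y, hY⟩ := (c.dtop_isInvertible he).surjective (c.dbot (P.proj e) X, 0)
  refine ⟨Y, (c.dbot_isInvertible (c.maps e he)).injective ?_⟩
  rw [c.dbot_dproj he, hY]

/-- The map `x ↦ xⁱ π_*(e_i)`, `ℝⁿ → T_{π(e)} M`. -/
def AdaptedFrame.horizontal (u : AdaptedFrame P) :
    Rn n →L[ℝ] TangentSpace 𝓘(ℝ, Rn n) (P.proj u.base) :=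
  P.dproj u.base ∘L u.toMap ∘L ContinuousLinearMap.inl ℝ (Rn n) (Rn k)

theorem AdaptedFrame.horizontal_bijective (u : AdaptedFrame P) :
    Function.Bijective u.horizontal := by
  have hs : Function.Surjective u.horizontal := by
    intro X
    obtain ⟨Y, rfl⟩ := P.dproj_surjective u.base X
    obtain ⟨⟨x, y⟩, rfl⟩ := u.bijective.2 Y
    refine ⟨x, ?_⟩
    have h : u.toMap (x, y) = u.toMap (x, 0) + u.toMap (0, y) := by simp [← map_add]
    rw [h, map_add, u.vertical]
    simp [horizontal]
  have hd : Module.finrank ℝ (Rn n) =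
      Module.finrank ℝ (TangentSpace 𝓘(ℝ, Rn n) (P.proj u.base)) := rfl
  exact ⟨(LinearMap.injective_iff_surjective_of_finrank_eq_finrank
    (f := u.horizontal.toLinearMap) hd).2 hs, hs⟩

theorem AdaptedFrame.horizontal_isInvertible (u : AdaptedFrame P) :
    u.horizontal.IsInvertible :=
  ⟨show Rn n ≃L[ℝ] Rn n from (LinearEquiv.ofBijective
    (show Rn n →ₗ[ℝ] Rn n from u.horizontal.toLinearMap)
    u.horizontal_bijective).toContinuousLinearEquiv, rfl⟩

/-- `ρ : L_π E → J¹π`, sending a frame `(e_i, e_A)` to the jet `τ` with `τ(π_*(e_i)) = e_i`. -/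
def rho (u : AdaptedFrame P) : Jet P where
  base := u.base
  τ := u.toMap ∘L ContinuousLinearMap.inl ℝ (Rn n) (Rn k) ∘L u.horizontal.inverse
  right_inv X := u.horizontal_isInvertible.self_apply_inverse X

theorem rho_τ (u : AdaptedFrame P) (x : Rn n) :
    (rho u).τ (P.dproj u.base (u.toMap (x, 0))) = u.toMap (x, 0) := by
  have h := u.horizontal_isInvertible.inverse_apply_self x
  exact congrArg (fun z => u.toMap (z, 0)) h

/-- `ρ_*`. -/
def drho (u : AdaptedFrame P) :
    TangentSpace 𝓘(ℝ, FrameModel n k) u →L[ℝ] TangentSpace 𝓘(ℝ, JetModel n k) (rho u) :=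
  mfderiv 𝓘(ℝ, FrameModel n k) 𝓘(ℝ, JetModel n k) (rho : AdaptedFrame P → Jet P) u

/-! ### Structures on `L_π E` -/

/-- The horizontal members `e_i` of a frame. -/
def AdaptedFrame.vec (u : AdaptedFrame P) (i : Fin n) :
    TangentSpace 𝓘(ℝ, Rn n × Rn k) u.base :=
  u.toMap (EuclideanSpace.single i 1, 0)

/-- The right action `u · g` of an invertible block lower triangular `g`. -/
def AdaptedFrame.act (u : AdaptedFrame P) (g : (Rn n × Rn k) →L[ℝ] Rn n × Rn k)
    (hg : Function.Bijective g) (hg' : ∀ y, (g (0, y)).1 = 0) : AdaptedFrame P where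
  base := u.base
  toMap := u.toMap ∘L g
  bijective := u.bijective.comp hg
  vertical y := by
    have : g (0, y) = (0, (g (0, y)).2) := Prod.ext (hg' y) rfl
    rw [ContinuousLinearMap.comp_apply, this, u.vertical]

theorem exp_bijective (ξ : (Rn n × Rn k) →L[ℝ] Rn n × Rn k) :
    Function.Bijective (NormedSpace.exp ξ : (Rn n × Rn k) →L[ℝ] Rn n × Rn k) := by
  let : NormedAlgebra ℚ ((Rn n × Rn k) →L[ℝ] Rn n × Rn k) := NormedAlgebra.restrictScalars ℚ ℝ _
  have : CompleteSpace ((Rn n × Rn k) →L[ℝ] Rn n × Rn k) := FiniteDimensional.complete ℝ _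
  exact (isUnit_iff_bijective _).1 (NormedSpace.isUnit_exp ξ)

theorem exp_lower (ξ : (Rn n × Rn k) →L[ℝ] Rn n × Rn k) (hξ : ∀ y, (ξ (0, y)).1 = 0) (y : Rn k) :
    ((NormedSpace.exp ξ : (Rn n × Rn k) →L[ℝ] Rn n × Rn k) (0, y)).1 = 0 := by
  have : CompleteSpace ((Rn n × Rn k) →L[ℝ] Rn n × Rn k) := FiniteDimensional.complete ℝ _
  have h := NormedSpace.exp_series_hasSum_exp' (𝕂 := ℝ) ξ
  have h1 := (h.mapL (ContinuousLinearMap.apply ℝ (Rn n × Rn k) ((0, y) : Rn n × Rn k))).mapL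
    (ContinuousLinearMap.fst ℝ (Rn n) (Rn k))
  have hp : ∀ (m : ℕ) (y : Rn k), ((ξ ^ m) (0, y)).1 = 0 := by
    intro m
    induction m with
    | zero => intro y; simp
    | succ m ih =>
      intro y
      have : ξ (0, y) = (0, (ξ (0, y)).2) := Prod.ext (hξ y) rfl
      rw [pow_succ, mul_apply_eq_comp, this]
      exact ih _
  have h2 : ∀ m : ℕ, (ContinuousLinearMap.fst ℝ (Rn n) (Rn k))
      ((ContinuousLinearMap.apply ℝ (Rn n × Rn k) ((0, y) : Rn n × Rn k))
        ((m.factorial⁻¹ : ℝ) • ξ ^ m)) = 0 := by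
    intro m
    have h3 := hp m y
    rw [map_smul, map_smul]
    exact (congrArg ((m.factorial⁻¹ : ℝ) • ·) h3).trans (smul_zero _)
  simp only [h2] at h1
  exact h1.unique hasSum_zero

/-- The curve `t ↦ u · exp(t ξ)`, for `ξ` in the Lie algebra of block lower triangular matrices. -/
def AdaptedFrame.expCurve (u : AdaptedFrame P)
    (v : (Rn n →L[ℝ] Rn n) × (Rn n →L[ℝ] Rn k) × (Rn k →L[ℝ] Rn k)) (t : ℝ) : AdaptedFrame P :=
  u.act (NormedSpace.exp (t • lowerBlock v)) (exp_bijective _)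
    (exp_lower _ fun y => by simp)

theorem AdaptedFrame.expCurve_zero (u : AdaptedFrame P)
    (v : (Rn n →L[ℝ] Rn n) × (Rn n →L[ℝ] Rn k) × (Rn k →L[ℝ] Rn k)) : u.expCurve v 0 = u := by
  have h : (NormedSpace.exp ((0 : ℝ) • lowerBlock v) : (Rn n × Rn k) →L[ℝ] Rn n × Rn k) =
      ContinuousLinearMap.id ℝ (Rn n × Rn k) := by
    have h0 : (0 : ℝ) • lowerBlock v = 0 := by
      refine ContinuousLinearMap.ext fun z => ?_
      simp
    rw [h0, NormedSpace.exp_zero]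
    rfl
  cases u
  simp only [expCurve, act, h, ContinuousLinearMap.comp_id]

/-- The fundamental vertical vector field `ξ*(u) = d/dt (u · exp(t ξ))` at `t = 0` (a curve through
`u`, by `AdaptedFrame.expCurve_zero`). -/
def fundamental (v : (Rn n →L[ℝ] Rn n) × (Rn n →L[ℝ] Rn k) × (Rn k →L[ℝ] Rn k))
    (u : AdaptedFrame P) : TangentSpace 𝓘(ℝ, FrameModel n k) u :=
  mfderiv 𝓘(ℝ, ℝ) 𝓘(ℝ, FrameModel n k) (u.expCurve v) 0 (1 : ℝ)

/-- The elementary linear map sending the `i`-th basis vector to the `j`-th one and all others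
to `0`. -/
def elementary {a b : ℕ} (i : Fin a) (j : Fin b) : Rn a →L[ℝ] Rn b :=
  (EuclideanSpace.proj i : Rn a →L[ℝ] ℝ).smulRight (EuclideanSpace.single j (1 : ℝ))

/-- `E*ⁱ_j`, whose flow replaces `e_i` by `e_i + t e_j` to first order. -/
def Ehh (i j : Fin n) (u : AdaptedFrame P) : TangentSpace 𝓘(ℝ, FrameModel n k) u :=
  fundamental (elementary i j, 0, 0) u

/-- `E*ⁱ_B`, whose flow replaces `e_i` by `e_i + t e_B`. -/
def Ehv (i : Fin n) (B : Fin k) (u : AdaptedFrame P) : TangentSpace 𝓘(ℝ, FrameModel n k) u :=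
  fundamental (0, elementary i B, 0) u

/-- `E*ᴬ_B`, whose flow replaces `e_A` by `e_A + t e_B` to first order. -/
def Evv (A B : Fin k) (u : AdaptedFrame P) : TangentSpace 𝓘(ℝ, FrameModel n k) u :=
  fundamental (0, 0, elementary A B) u

/-- `λ_*`, where `λ : L_π E → E`. -/
def AdaptedFrame.dbase (u : AdaptedFrame P) :
    TangentSpace 𝓘(ℝ, FrameModel n k) u →L[ℝ] TangentSpace 𝓘(ℝ, Rn n × Rn k) u.base :=
  mfderiv 𝓘(ℝ, FrameModel n k) 𝓘(ℝ, Rn n × Rn k) (AdaptedFrame.base : AdaptedFrame P → E) u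

/-- `π ∘ λ : L_π E → M`. -/
abbrev AdaptedFrame.proj (u : AdaptedFrame P) : M := P.proj u.base

/-- `(π ∘ λ)_*`. -/
def AdaptedFrame.dproj (u : AdaptedFrame P) :
    TangentSpace 𝓘(ℝ, FrameModel n k) u →L[ℝ] TangentSpace 𝓘(ℝ, Rn n) u.proj :=
  mfderiv 𝓘(ℝ, FrameModel n k) 𝓘(ℝ, Rn n) (AdaptedFrame.proj : AdaptedFrame P → M) u

/-- The soldering form `(θⁱ, θᴬ)`: the components of `λ_* X` in the frame `u`. -/
def AdaptedFrame.solder (u : AdaptedFrame P) :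
    TangentSpace 𝓘(ℝ, FrameModel n k) u →ₗ[ℝ] Rn n × Rn k :=
  (LinearEquiv.ofBijective u.toMap.toLinearMap u.bijective).symm.toLinearMap ∘ₗ
    u.dbase.toLinearMap

/-- A family `B_1, …, B_n` of vector fields on `L_π E` with `λ_*(B_i(u)) = e_i`. The standard
horizontal vector fields `B(r̂_i)` of any linear connection have this property. -/
def IsStandardFamily (B : Fin n → ∀ u : AdaptedFrame P, TangentSpace 𝓘(ℝ, FrameModel n k) u) :
    Prop :=
  ∀ (i : Fin n) (u : AdaptedFrame P), u.dbase (B i u) = u.vec i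

/-- The vector-valued `1`-forms `S̃_α = ((π ∘ λ)^* α)(B_i) E*ⁱ_C ⊗ θᶜ` on `L_π E`. -/
def AdaptedFrame.S (B : Fin n → ∀ u : AdaptedFrame P, TangentSpace 𝓘(ℝ, FrameModel n k) u)
    (u : AdaptedFrame P) : Module.Dual ℝ (TangentSpace 𝓘(ℝ, Rn n) u.proj) →ₗ[ℝ]
    TangentSpace 𝓘(ℝ, FrameModel n k) u → TangentSpace 𝓘(ℝ, FrameModel n k) u where
  toFun α X := ∑ i, ∑ C, (α (u.dproj (B i u)) * (u.solder X).2 C) • Ehv i C u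
  map_add' α β := by
    ext X
    simp [add_mul, add_smul, Finset.sum_add_distrib]
  map_smul' a α := by
    ext X
    simp [mul_assoc, mul_smul, Finset.smul_sum]

/-- The vector-valued `n`-form `S̃_ω` on `L_π E`. -/
def AdaptedFrame.Somega
    (B : Fin n → ∀ u : AdaptedFrame P, TangentSpace 𝓘(ℝ, FrameModel n k) u)
    (vol : ∀ x : M, TangentSpace 𝓘(ℝ, Rn n) x [⋀^Fin n]→ₗ[ℝ] ℝ) (u : AdaptedFrame P)
    (X : Fin n → TangentSpace 𝓘(ℝ, FrameModel n k) u) : TangentSpace 𝓘(ℝ, FrameModel n k) u :=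
  volumeTensor u.dproj.toLinearMap (u.S B) (vol u.proj) X

/-- The differential `dL` of a function on `L_π E`. -/
def AdaptedFrame.d (L : AdaptedFrame P → ℝ) (u : AdaptedFrame P) :
    TangentSpace 𝓘(ℝ, FrameModel n k) u →L[ℝ] ℝ :=
  mfderiv 𝓘(ℝ, FrameModel n k) 𝓘(ℝ, ℝ) L u

/-- A Lagrangian `L` on `L_π E` is lifted if `E*ⁱ_j(L) = 0` and `E*ᴬ_B(L) = 0`. -/
def IsLifted (L : AdaptedFrame P → ℝ) : Prop :=
  (∀ (i j : Fin n) (u : AdaptedFrame P), AdaptedFrame.d L u (Ehh i j u) = 0) ∧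
    ∀ (A B : Fin k) (u : AdaptedFrame P), AdaptedFrame.d L u (Evv A B u) = 0

/-- The form `θ_L = L ω + dL ∘ S̃_ω` on `L_π E`. -/
def frameForm (B : Fin n → ∀ u : AdaptedFrame P, TangentSpace 𝓘(ℝ, FrameModel n k) u)
    (vol : ∀ x : M, TangentSpace 𝓘(ℝ, Rn n) x [⋀^Fin n]→ₗ[ℝ] ℝ) (L : AdaptedFrame P → ℝ)
    (u : AdaptedFrame P) (X : Fin n → TangentSpace 𝓘(ℝ, FrameModel n k) u) : ℝ :=
  L u * vol u.proj (fun i => u.dproj (X i)) + AdaptedFrame.d L u (u.Somega B vol X)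

/-- The pull-back `ρ^* Θ` of an `n`-form `Θ` on `J¹π` to `L_π E`. -/
def rhoPullback (Θ : ∀ j : Jet P, (Fin n → TangentSpace 𝓘(ℝ, JetModel n k) j) → ℝ)
    (u : AdaptedFrame P) (X : Fin n → TangentSpace 𝓘(ℝ, FrameModel n k) u) : ℝ :=
  Θ (rho u) (fun i => drho u (X i))

end Geometry

end

end FieldTheory

end

open scoped Manifold ContDiff Topology

set_option linter.unusedSectionVars false

noncomputable section

namespace FieldTheory

variable {n k : ℕ} {M E : Type*}
  [TopologicalSpace M] [ChartedSpace (Rn n) M] [TopologicalSpace E]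
  [ChartedSpace (Rn n × Rn k) E] [IsManifold 𝓘(ℝ, Rn n × Rn k) ∞ E]
  {P : FiberedManifold n k M E} (c : AdaptedChart P)

/-! In adapted coordinates a frame is a point `z` of `E` together with a block lower triangular
matrix with diagonal blocks `a` (size `n`) and `d` (size `k`) and lower left block `b`. The jet it
defines has slope `b a⁻¹`, so `ρ` reads `(z, a, b, d) ↦ (z, b a⁻¹)`. Hence `ρ` is smooth and
surjective, the pair `(a, d)` parametrises its fibres, and freezing `(a, d)` gives smooth local
sections.

The two Cartan–Hamilton–Poincaré forms agree because `ρ_*` intertwines the tensors they are built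
from. The contact form at `ρ(u)`, pulled back by `ρ`, is `e_A θᴬ`, since `τ` reproduces exactly the
horizontal part of `λ_* X` (`contactForm_drho`). The field `E*ⁱ_B` moves only `b`, in which `ρ` is
affine, so `ρ_* E*ⁱ_B` is the vertical lift of the `i`-th dual vector times `e_B`. Together these
give `ρ_* ∘ S̃_α = S_α ∘ ρ_*` (`drho_S`). The defining formulas of `Sσ` and `S_ω` are dual to this,
so it passes to `ρ_* ∘ S̃_ω = S_ω ∘ ρ_*` (`drho_Somega`). If `ρ^*ℒ = L` near `u` then `dL = dℒ ∘
ρ_*` there, and the equality of forms follows (`rhoPullback_chpForm`). The argument is pointwise, so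
it serves both the global and the local statement.

For the existence of `ℒ`: the fields `E*ⁱ_j` and `E*ᴬ_B` span the tangent spaces of the fibres of
`ρ`, so a lifted `L` has zero derivative along them (`IsLifted.hasFDerivAt_frameOver`). Each fibre
looks like `GL(n) × GL(k)`, which need not be connected, so `L` is only locally constant on it.
Restricting `(a, d)` to a ball of invertible pairs makes `L` a function of the jet alone
(`IsLifted.exists_local`). A global `ℒ` exists once constancy on the fibres is assumed, and it is
unique because `ρ` is onto. Its smoothness comes from composing `L` with local sections
(`contMDiff_of_comp_rho`). -/

/-! ### Jet and frame coordinates as charts -/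

/-- Jet coordinates as a chart of `J¹π`. -/
def AdaptedChart.jetHomeo (j₀ : Jet P) : OpenPartialHomeomorph (Jet P) (JetModel n k) :=
  (jetCore P).openPartialHomeomorph (c.jetChart j₀) ⟨c, j₀, rfl⟩

/-- Frame coordinates as a chart of `L_π E`. -/
def AdaptedChart.frameHomeo (u₀ : AdaptedFrame P) :
    OpenPartialHomeomorph (AdaptedFrame P) (FrameModel n k) :=
  (frameCore P).openPartialHomeomorph (c.frameChart u₀) ⟨c, u₀, rfl⟩

theorem AdaptedChart.jetHomeo_mem (j₀ : Jet P) :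
    c.jetHomeo j₀ ∈ IsManifold.maximalAtlas 𝓘(ℝ, JetModel n k) ∞ (Jet P) :=
  IsManifold.subset_maximalAtlas ⟨_, ⟨c.jetChart j₀, rfl⟩, ⟨_, ⟨⟨c, j₀, rfl⟩, rfl⟩, rfl⟩⟩

theorem AdaptedChart.frameHomeo_mem (u₀ : AdaptedFrame P) :
    c.frameHomeo u₀ ∈ IsManifold.maximalAtlas 𝓘(ℝ, FrameModel n k) ∞ (AdaptedFrame P) :=
  IsManifold.subset_maximalAtlas ⟨_, ⟨c.frameChart u₀, rfl⟩, ⟨_, ⟨⟨c, u₀, rfl⟩, rfl⟩, rfl⟩⟩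

theorem AdaptedChart.contMDiffOn_jetHomeo_symm (j₀ : Jet P) :
    ContMDiffOn 𝓘(ℝ, JetModel n k) 𝓘(ℝ, JetModel n k) ∞ (c.jetHomeo j₀).symm
      (c.top.target ×ˢ Set.univ) :=
  contMDiffOn_symm_of_mem_maximalAtlas (c.jetHomeo_mem j₀)

theorem AdaptedChart.contMDiffOn_frameHomeo_symm (u₀ : AdaptedFrame P) :
    ContMDiffOn 𝓘(ℝ, FrameModel n k) 𝓘(ℝ, FrameModel n k) ∞ (c.frameHomeo u₀).symm
      (c.top.target ×ˢ frameUnits n k) :=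
  contMDiffOn_symm_of_mem_maximalAtlas (c.frameHomeo_mem u₀)

theorem AdaptedChart.isOpen_jet_source : IsOpen {j : Jet P | j.base ∈ c.top.source} := by
  -- The chart needs a filler point `j₀`, so an empty jet bundle is treated separately.
  rcases isEmpty_or_nonempty (Jet P) with h | ⟨⟨j₀⟩⟩
  · rw [Set.eq_empty_of_isEmpty {j : Jet P | j.base ∈ c.top.source}]
    exact isOpen_empty
  · exact (c.jetHomeo j₀).open_source

theorem AdaptedChart.isOpen_frame_source :
    IsOpen {u : AdaptedFrame P | u.base ∈ c.top.source} := by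
  rcases isEmpty_or_nonempty (AdaptedFrame P) with h | ⟨⟨u₀⟩⟩
  · rw [Set.eq_empty_of_isEmpty {u : AdaptedFrame P | u.base ∈ c.top.source}]
    exact isOpen_empty
  · exact (c.frameHomeo u₀).open_source

theorem AdaptedChart.contMDiffAt_jetCoord {j : Jet P} (hj : j.base ∈ c.top.source) :
    ContMDiffAt 𝓘(ℝ, JetModel n k) 𝓘(ℝ, JetModel n k) ∞ c.jetCoord j :=
  (contMDiffOn_of_mem_maximalAtlas (c.jetHomeo_mem j)).contMDiffAt
    (c.isOpen_jet_source.mem_nhds hj)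

theorem AdaptedChart.contMDiffAt_frameCoord {u : AdaptedFrame P} (hu : u.base ∈ c.top.source) :
    ContMDiffAt 𝓘(ℝ, FrameModel n k) 𝓘(ℝ, FrameModel n k) ∞ c.frameCoord u :=
  (contMDiffOn_of_mem_maximalAtlas (c.frameHomeo_mem u)).contMDiffAt
    (c.isOpen_frame_source.mem_nhds hu)

/-- A map into `J¹π` whose base point stays in the domain of adapted coordinates is smooth where
its jet coordinates are. -/
theorem AdaptedChart.contMDiffAt_of_jetCoord {V : Type*} [NormedAddCommGroup V] [NormedSpace ℝ V]
    {X : Type*} [TopologicalSpace X] [ChartedSpace V X] {f : X → Jet P} {x : X}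
    (hf : ∀ᶠ y in 𝓝 x, (f y).base ∈ c.top.source)
    (h : ContMDiffAt 𝓘(ℝ, V) 𝓘(ℝ, JetModel n k) ∞ (c.jetCoord ∘ f) x) :
    ContMDiffAt 𝓘(ℝ, V) 𝓘(ℝ, JetModel n k) ∞ f x := by
  have hx := hf.self_of_nhds
  have hm : c.jetCoord (f x) ∈ c.top.target ×ˢ (Set.univ : Set (Rn n →L[ℝ] Rn k)) :=
    c.jetCoord_bijOn.mapsTo hx
  have h1 := ((c.contMDiffOn_jetHomeo_symm (f x)).contMDiffAt
    ((c.top.open_target.prod isOpen_univ).mem_nhds hm)).comp x h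
  refine h1.congr_of_eventuallyEq ?_
  filter_upwards [hf] with y hy
  exact ((c.jetHomeo (f x)).left_inv hy).symm

/-- A map into `L_π E` whose base point stays in the domain of adapted coordinates is smooth where
its frame coordinates are. -/
theorem AdaptedChart.contMDiffAt_of_frameCoord {V : Type*} [NormedAddCommGroup V]
    [NormedSpace ℝ V] {X : Type*} [TopologicalSpace X] [ChartedSpace V X]
    {f : X → AdaptedFrame P} {x : X} (hf : ∀ᶠ y in 𝓝 x, (f y).base ∈ c.top.source)
    (h : ContMDiffAt 𝓘(ℝ, V) 𝓘(ℝ, FrameModel n k) ∞ (c.frameCoord ∘ f) x) :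
    ContMDiffAt 𝓘(ℝ, V) 𝓘(ℝ, FrameModel n k) ∞ f x := by
  have hx := hf.self_of_nhds
  have hm : c.frameCoord (f x) ∈ c.top.target ×ˢ frameUnits n k :=
    c.frameCoord_bijOn.mapsTo hx
  have h1 := ((c.contMDiffOn_frameHomeo_symm (f x)).contMDiffAt
    ((c.top.open_target.prod (isOpen_frameUnits n k)).mem_nhds hm)).comp x h
  refine h1.congr_of_eventuallyEq ?_
  filter_upwards [hf] with y hy
  exact ((c.frameHomeo (f x)).left_inv hy).symm

theorem AdaptedChart.contMDiffAt_top_symm {e : E} (he : e ∈ c.top.source) :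
    ContMDiffAt 𝓘(ℝ, Rn n × Rn k) 𝓘(ℝ, Rn n × Rn k) ∞ c.top.symm (c.top e) :=
  (contMDiffOn_symm_of_mem_maximalAtlas c.top_mem).contMDiffAt
    (c.top.open_target.mem_nhds (c.top.map_source he))

/-- The projection `π₁,₀` is smooth. -/
theorem Jet.contMDiff_base :
    ContMDiff 𝓘(ℝ, JetModel n k) 𝓘(ℝ, Rn n × Rn k) ∞ (Jet.base : Jet P → E) := by
  intro j
  have hj := mem_adaptedChartAt P j.base
  set c := adaptedChartAt P j.base
  have h1 : ContMDiffAt 𝓘(ℝ, JetModel n k) 𝓘(ℝ, Rn n × Rn k) ∞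
      (fun j' : Jet P => (c.jetCoord j').1) j :=
    (contDiff_fst.contMDiff.contMDiffAt (x := c.jetCoord j)).comp j (c.contMDiffAt_jetCoord hj)
  have h2 : ContMDiffAt 𝓘(ℝ, JetModel n k) 𝓘(ℝ, Rn n × Rn k) ∞
      (c.top.symm ∘ fun j' : Jet P => (c.jetCoord j').1) j :=
    ContMDiffAt.comp j (c.contMDiffAt_top_symm hj) h1
  refine h2.congr_of_eventuallyEq ?_
  filter_upwards [c.isOpen_jet_source.mem_nhds hj] with j' hj'
  exact (c.top.left_inv hj').symm

/-- The projection `λ` is smooth. -/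
theorem AdaptedFrame.contMDiff_base :
    ContMDiff 𝓘(ℝ, FrameModel n k) 𝓘(ℝ, Rn n × Rn k) ∞ (AdaptedFrame.base : AdaptedFrame P → E) := by
  intro u
  have hu := mem_adaptedChartAt P u.base
  set c := adaptedChartAt P u.base
  have h1 : ContMDiffAt 𝓘(ℝ, FrameModel n k) 𝓘(ℝ, Rn n × Rn k) ∞
      (fun u' : AdaptedFrame P => (c.frameCoord u').1) u :=
    (contDiff_fst.contMDiff.contMDiffAt (x := c.frameCoord u)).comp u
      (c.contMDiffAt_frameCoord hu)
  have h2 : ContMDiffAt 𝓘(ℝ, FrameModel n k) 𝓘(ℝ, Rn n × Rn k) ∞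
      (c.top.symm ∘ fun u' : AdaptedFrame P => (c.frameCoord u').1) u :=
    ContMDiffAt.comp u (c.contMDiffAt_top_symm hu) h1
  refine h2.congr_of_eventuallyEq ?_
  filter_upwards [c.isOpen_frame_source.mem_nhds hu] with u' hu'
  exact (c.top.left_inv hu').symm

/-! ### Differentials of jet and frame coordinates -/

/-- The differential of the jet coordinates at `j`. -/
def AdaptedChart.djetCoord (j : Jet P) :
    TangentSpace 𝓘(ℝ, JetModel n k) j →L[ℝ] JetModel n k :=
  mfderiv 𝓘(ℝ, JetModel n k) 𝓘(ℝ, JetModel n k) c.jetCoord j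

/-- The differential of the frame coordinates at `u`. -/
def AdaptedChart.dframeCoord (u : AdaptedFrame P) :
    TangentSpace 𝓘(ℝ, FrameModel n k) u →L[ℝ] FrameModel n k :=
  mfderiv 𝓘(ℝ, FrameModel n k) 𝓘(ℝ, FrameModel n k) c.frameCoord u

theorem AdaptedChart.hasMFDerivAt_jetCoord {j : Jet P} (hj : j.base ∈ c.top.source) :
    HasMFDerivAt 𝓘(ℝ, JetModel n k) 𝓘(ℝ, JetModel n k) c.jetCoord j (c.djetCoord j) :=
  ((c.contMDiffAt_jetCoord hj).mdifferentiableAt (by simp)).hasMFDerivAt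

theorem AdaptedChart.hasMFDerivAt_frameCoord {u : AdaptedFrame P} (hu : u.base ∈ c.top.source) :
    HasMFDerivAt 𝓘(ℝ, FrameModel n k) 𝓘(ℝ, FrameModel n k) c.frameCoord u (c.dframeCoord u) :=
  ((c.contMDiffAt_frameCoord hu).mdifferentiableAt (by simp)).hasMFDerivAt

/-- The coordinates form a diffeomorphism onto an open set. Identities between tangent vectors of
`J¹π` can therefore be checked in coordinates. -/
theorem AdaptedChart.djetCoord_injective {j : Jet P} (hj : j.base ∈ c.top.source) :
    Function.Injective (c.djetCoord j) := by
  have h : (c.jetHomeo j).MDifferentiable 𝓘(ℝ, JetModel n k) 𝓘(ℝ, JetModel n k) :=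
    ⟨(contMDiffOn_of_mem_maximalAtlas (c.jetHomeo_mem j)).mdifferentiableOn (by simp),
      (contMDiffOn_symm_of_mem_maximalAtlas (c.jetHomeo_mem j)).mdifferentiableOn (by simp)⟩
  exact h.mfderiv_injective hj

theorem AdaptedChart.dframeCoord_injective {u : AdaptedFrame P} (hu : u.base ∈ c.top.source) :
    Function.Injective (c.dframeCoord u) := by
  have h : (c.frameHomeo u).MDifferentiable 𝓘(ℝ, FrameModel n k) 𝓘(ℝ, FrameModel n k) :=
    ⟨(contMDiffOn_of_mem_maximalAtlas (c.frameHomeo_mem u)).mdifferentiableOn (by simp),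
      (contMDiffOn_symm_of_mem_maximalAtlas (c.frameHomeo_mem u)).mdifferentiableOn (by simp)⟩
  exact h.mfderiv_injective hu

instance instContinuousSMulFrameModel (n k : ℕ) : ContinuousSMul ℝ (FrameModel n k) :=
  IsBoundedSMul.continuousSMul

instance instContinuousSMulJetModel (n k : ℕ) : ContinuousSMul ℝ (JetModel n k) :=
  IsBoundedSMul.continuousSMul

instance instCompleteSpaceEnd (n k : ℕ) :
    CompleteSpace ((Rn n × Rn k) →L[ℝ] Rn n × Rn k) :=
  FiniteDimensional.complete ℝ _

/-! ### The projection `ρ` in coordinates -/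

/-- The projection `ρ` in frame and jet coordinates: `(z, a, b, d) ↦ (z, b a⁻¹)`. -/
def jetOfFrame (w : FrameModel n k) : JetModel n k :=
  (w.1, w.2.2.1 ∘L Ring.inverse w.2.1)

theorem AdaptedChart.dtop_toMap {u : AdaptedFrame P} (hu : u.base ∈ c.top.source) (x : Rn n)
    (y : Rn k) : c.dtop u.base (u.toMap (x, y)) =
      ((c.frameCoord u).2.1 x, (c.frameCoord u).2.2.1 x + (c.frameCoord u).2.2.2 y) := by
  rw [← lowerBlock_apply, c.lowerBlock_frameCoord hu]
  rfl

theorem AdaptedChart.frameCoord_mem {u : AdaptedFrame P} (hu : u.base ∈ c.top.source) :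
    (c.frameCoord u).2 ∈ frameUnits n k :=
  (c.frameCoord_bijOn.mapsTo hu).2

/-- The upper diagonal block `a` is the coordinate matrix of the projected frame `π_* e_i`. This
links `a⁻¹` with the inverse occurring in `rho`. -/
theorem AdaptedChart.dbot_horizontal {u : AdaptedFrame P} (hu : u.base ∈ c.top.source) (x : Rn n) :
    c.dbot (P.proj u.base) (u.horizontal x) = (c.frameCoord u).2.1 x := by
  have h := c.dbot_dproj hu (u.toMap (x, 0))
  rw [c.dtop_toMap hu] at h
  exact h

/-- The slope `p` of the jet is determined by `τ(π_* e_i) = e_i`. In coordinates this says `p a =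
b`, and `a` is invertible on adapted frames. -/
theorem AdaptedChart.jetCoord_rho {u : AdaptedFrame P} (hu : u.base ∈ c.top.source) :
    c.jetCoord (rho u) = jetOfFrame (c.frameCoord u) := by
  refine Prod.ext rfl ?_
  have h : (c.jetCoord (rho u)).2 ∘L (c.frameCoord u).2.1 = (c.frameCoord u).2.2.1 := by
    ext1 x
    have h1 := c.dtop_jet (j := rho u) hu (u.horizontal x)
    have h2 : (rho u).τ (u.horizontal x) = u.toMap (x, 0) := rho_τ u x
    rw [h2] at h1
    have h3 := congrArg Prod.snd ((c.dtop_toMap hu x 0).symm.trans h1)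
    have h4 := c.dbot_horizontal hu x
    change _ = (c.jetCoord (rho u)).2 (c.dbot (P.proj u.base) (u.horizontal x)) at h3
    rw [h4] at h3
    simpa using h3.symm
  change _ = (c.frameCoord u).2.2.1 ∘L Ring.inverse (c.frameCoord u).2.1
  rw [← h, ContinuousLinearMap.comp_assoc]
  have h5 : (c.frameCoord u).2.1 ∘L Ring.inverse (c.frameCoord u).2.1 =
      ContinuousLinearMap.id ℝ (Rn n) :=
    Ring.mul_inverse_cancel _ (c.frameCoord_mem hu).1
  rw [h5, ContinuousLinearMap.comp_id]

theorem contDiffAt_jetOfFrame {w : FrameModel n k} (hw : IsUnit w.2.1) :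
    ContDiffAt ℝ ∞ (jetOfFrame : FrameModel n k → JetModel n k) w := by
  obtain ⟨a, ha⟩ := hw
  have h1 : ContDiffAt ℝ ∞ (Ring.inverse : (Rn n →L[ℝ] Rn n) → _) w.2.1 :=
    ha ▸ contDiffAt_ringInverse ℝ a
  have h2 : ContDiffAt ℝ ∞ (fun w : FrameModel n k => Ring.inverse w.2.1) w :=
    h1.comp w (contDiffAt_fst.comp w contDiffAt_snd)
  exact contDiffAt_fst.prodMk
    ((contDiffAt_fst.comp w (contDiffAt_snd.comp w contDiffAt_snd)).clm_comp h2)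

theorem clm_smul_zero {V W : Type*} [NormedAddCommGroup V] [NormedSpace ℝ V]
    [NormedAddCommGroup W] [NormedSpace ℝ W] (t : ℝ) : t • (0 : V →L[ℝ] W) = 0 :=
  ContinuousLinearMap.ext fun x => by simp

theorem hasDerivAt_line {V : Type*} [NormedAddCommGroup V] [NormedSpace ℝ V] (a b : V) :
    HasDerivAt (fun t : ℝ => a + t • b) b 0 := by
  simpa using ((hasDerivAt_id (0 : ℝ)).smul_const b).const_add a

/-- `b ↦ b a⁻¹` is linear, so the derivative can be read off a straight line and that of matrix
inversion never enters. Only this direction is needed, since `S̃_α` takes values in the span of the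
`E*ⁱ_B`. -/
theorem fderiv_jetOfFrame {w : FrameModel n k} (hw : IsUnit w.2.1) (β : Rn n →L[ℝ] Rn k) :
    fderiv ℝ (jetOfFrame : FrameModel n k → JetModel n k) w (0, 0, β, 0) =
      (0, β ∘L Ring.inverse w.2.1) := by
  have h1 := ((contDiffAt_jetOfFrame hw).differentiableAt (by simp)).hasFDerivAt
  have h0 : HasDerivAt (fun t : ℝ => w + t • ((0, 0, β, 0) : FrameModel n k)) (0, 0, β, 0) 0 :=
    hasDerivAt_line _ _
  have h2 := HasFDerivAt.comp_hasDerivAt_of_eq (0 : ℝ) h1 h0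
    (by rw [zero_smul ℝ ((0, 0, β, 0) : FrameModel n k), add_zero])
  have h3 : HasDerivAt (fun t : ℝ => jetOfFrame w +
      t • ((0, β ∘L Ring.inverse w.2.1) : JetModel n k)) (0, β ∘L Ring.inverse w.2.1) 0 :=
    hasDerivAt_line _ _
  refine h2.unique (h3.congr_of_eventuallyEq (Filter.Eventually.of_forall fun t => ?_))
  refine Prod.ext ?_ ?_
  · simp [jetOfFrame]
  · ext1 x
    simp [jetOfFrame, clm_smul_zero]

theorem contMDiff_rho : ContMDiff 𝓘(ℝ, FrameModel n k) 𝓘(ℝ, JetModel n k) ∞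
    (rho : AdaptedFrame P → Jet P) := by
  intro u
  have hu := mem_adaptedChartAt P u.base
  set c := adaptedChartAt P u.base
  refine c.contMDiffAt_of_jetCoord (c.isOpen_frame_source.mem_nhds hu) ?_
  have h1 : ContMDiffAt 𝓘(ℝ, FrameModel n k) 𝓘(ℝ, JetModel n k) ∞ (jetOfFrame ∘ c.frameCoord) u :=
    (contDiffAt_jetOfFrame (c.frameCoord_mem hu).1).contMDiffAt.comp u (c.contMDiffAt_frameCoord hu)
  refine h1.congr_of_eventuallyEq ?_
  filter_upwards [c.isOpen_frame_source.mem_nhds hu] with u' hu'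
  exact c.jetCoord_rho hu'

theorem hasMFDerivAt_rho (u : AdaptedFrame P) :
    HasMFDerivAt 𝓘(ℝ, FrameModel n k) 𝓘(ℝ, JetModel n k) (rho : AdaptedFrame P → Jet P) u
      (drho u) :=
  (contMDiff_rho.mdifferentiableAt (by simp)).hasMFDerivAt

/-- Near `u`, `ρ` is `jetOfFrame` in coordinates; this is the chain rule for both sides of that
identity. -/
theorem AdaptedChart.djetCoord_drho {u : AdaptedFrame P} (hu : u.base ∈ c.top.source)
    (X : TangentSpace 𝓘(ℝ, FrameModel n k) u) :
    c.djetCoord (rho u) (drho u X) =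
      fderiv ℝ (jetOfFrame : FrameModel n k → JetModel n k) (c.frameCoord u)
        (c.dframeCoord u X) := by
  have h1 := (c.hasMFDerivAt_jetCoord (j := rho u) hu).comp u (hasMFDerivAt_rho u)
  have h2 := ((contDiffAt_jetOfFrame (c.frameCoord_mem hu).1).differentiableAt
    (by simp)).hasFDerivAt.hasMFDerivAt.comp u (c.hasMFDerivAt_frameCoord hu)
  refine DFunLike.congr_fun (hasMFDerivAt_unique (h1.congr_of_eventuallyEq ?_) h2) X
  filter_upwards [c.isOpen_frame_source.mem_nhds hu] with u' hu'
  exact (c.jetCoord_rho hu').symm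

/-- `ρ` covers the identity of `E`: `π₁,₀ ∘ ρ = λ` holds by definition. -/
theorem dbase_drho (u : AdaptedFrame P) (X : TangentSpace 𝓘(ℝ, FrameModel n k) u) :
    (rho u).dbase (drho u X) = u.dbase X := by
  have h1 : HasMFDerivAt 𝓘(ℝ, FrameModel n k) 𝓘(ℝ, Rn n × Rn k) (Jet.base ∘ rho) u
      ((rho u).dbase.comp (drho u)) :=
    (Jet.contMDiff_base.mdifferentiableAt (by simp)).hasMFDerivAt.comp u (hasMFDerivAt_rho u)
  exact (DFunLike.congr_fun h1.mfderiv X).symm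

theorem Jet.dproj_eq (j : Jet P) (X : TangentSpace 𝓘(ℝ, JetModel n k) j) :
    j.dproj X = P.dproj j.base (j.dbase X) := by
  have h1 : HasMFDerivAt 𝓘(ℝ, JetModel n k) 𝓘(ℝ, Rn n) (P.proj ∘ Jet.base) j
      ((P.dproj j.base).comp j.dbase) :=
    (P.mdifferentiableAt_proj j.base).hasMFDerivAt.comp j
      (Jet.contMDiff_base.mdifferentiableAt (by simp)).hasMFDerivAt
  exact DFunLike.congr_fun h1.mfderiv X

theorem AdaptedFrame.dproj_eq (u : AdaptedFrame P) (X : TangentSpace 𝓘(ℝ, FrameModel n k) u) :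
    u.dproj X = P.dproj u.base (u.dbase X) := by
  have h1 : HasMFDerivAt 𝓘(ℝ, FrameModel n k) 𝓘(ℝ, Rn n) (P.proj ∘ AdaptedFrame.base) u
      ((P.dproj u.base).comp u.dbase) :=
    (P.mdifferentiableAt_proj u.base).hasMFDerivAt.comp u
      (AdaptedFrame.contMDiff_base.mdifferentiableAt (by simp)).hasMFDerivAt
  exact DFunLike.congr_fun h1.mfderiv X

theorem dproj_drho (u : AdaptedFrame P) (X : TangentSpace 𝓘(ℝ, FrameModel n k) u) :
    (rho u).dproj (drho u X) = u.dproj X := by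
  rw [Jet.dproj_eq, dbase_drho]
  exact (u.dproj_eq X).symm

/-! ### Fundamental vector fields and vertical lifts in coordinates -/

theorem lowerBlock_comp
    (w v : (Rn n →L[ℝ] Rn n) × (Rn n →L[ℝ] Rn k) × (Rn k →L[ℝ] Rn k)) :
    lowerBlock w ∘L lowerBlock v =
      lowerBlock (w.1 ∘L v.1, w.2.1 ∘L v.1 + w.2.2 ∘L v.2.1, w.2.2 ∘L v.2.2) := by
  refine ContinuousLinearMap.ext fun ⟨x, y⟩ => ?_
  simp [add_assoc]

theorem AdaptedChart.frameCoord_expCurve {u : AdaptedFrame P} (hu : u.base ∈ c.top.source)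
    (v : (Rn n →L[ℝ] Rn n) × (Rn n →L[ℝ] Rn k) × (Rn k →L[ℝ] Rn k)) (t : ℝ) :
    c.frameCoord (u.expCurve v t) =
      (c.top u.base, blocks (lowerBlock (c.frameCoord u).2 ∘L
        (NormedSpace.exp (t • lowerBlock v) : (Rn n × Rn k) →L[ℝ] Rn n × Rn k))) := by
  rw [c.lowerBlock_frameCoord hu]
  rfl

/-- `blocks` as a continuous linear map. -/
def blocksL (n k : ℕ) : ((Rn n × Rn k) →L[ℝ] Rn n × Rn k) →L[ℝ]
    (Rn n →L[ℝ] Rn n) × (Rn n →L[ℝ] Rn k) × (Rn k →L[ℝ] Rn k) where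
  toFun := blocks
  map_add' x y := by simp [blocks]
  map_smul' r x := by simp [blocks]
  cont := by
    unfold blocks
    fun_prop

/-- In coordinates the action is matrix multiplication on the right, and the derivative of `exp(t
ξ)` at `0` is `ξ`. -/
theorem AdaptedChart.hasDerivAt_frameCoord_expCurve {u : AdaptedFrame P}
    (hu : u.base ∈ c.top.source)
    (v : (Rn n →L[ℝ] Rn n) × (Rn n →L[ℝ] Rn k) × (Rn k →L[ℝ] Rn k)) :
    HasDerivAt (c.frameCoord ∘ u.expCurve v)
      (0, blocks (lowerBlock (c.frameCoord u).2 ∘L lowerBlock v)) 0 := by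
  have h1 := hasDerivAt_exp_smul_const (𝕂 := ℝ) (lowerBlock v) 0
  rw [zero_smul ℝ (lowerBlock v), NormedSpace.exp_zero, one_mul] at h1
  have h2 := (hasDerivAt_const (0 : ℝ) (lowerBlock (c.frameCoord u).2)).clm_comp h1
  rw [ContinuousLinearMap.zero_comp, zero_add] at h2
  have h3 := (blocksL n k).hasFDerivAt.comp_hasDerivAt (0 : ℝ) h2
  have h4 := (hasDerivAt_const (0 : ℝ) (c.top u.base)).prodMk h3
  have h5 : c.frameCoord ∘ u.expCurve v = fun t : ℝ => (c.top u.base, (blocksL n k)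
      (lowerBlock (c.frameCoord u).2 ∘L NormedSpace.exp (t • lowerBlock v))) :=
    funext fun t => c.frameCoord_expCurve hu v t
  rw [h5]
  exact h4

theorem AdaptedChart.contDiff_frameCoord_expCurve {u : AdaptedFrame P}
    (hu : u.base ∈ c.top.source)
    (v : (Rn n →L[ℝ] Rn n) × (Rn n →L[ℝ] Rn k) × (Rn k →L[ℝ] Rn k)) :
    ContDiff ℝ ∞ (c.frameCoord ∘ u.expCurve v) := by
  have h1 : ContDiff ℝ ∞ (NormedSpace.exp : ((Rn n × Rn k) →L[ℝ] Rn n × Rn k) → _) :=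
    contDiff_iff_contDiffAt.2 fun x => (NormedSpace.exp_analytic (𝕂 := ℝ) x).contDiffAt
  have h2 : ContDiff ℝ ∞ (fun t : ℝ => NormedSpace.exp (t • lowerBlock v)) :=
    h1.comp (contDiff_id.smul contDiff_const)
  have h3 := (blocksL n k).contDiff.comp
    ((contDiff_const (c := lowerBlock (c.frameCoord u).2)).clm_comp h2)
  have h5 : c.frameCoord ∘ u.expCurve v = fun t : ℝ => (c.top u.base, (blocksL n k)
      (lowerBlock (c.frameCoord u).2 ∘L NormedSpace.exp (t • lowerBlock v))) :=
    funext fun t => c.frameCoord_expCurve hu v t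
  rw [h5]
  exact contDiff_const.prodMk h3

/-- The fundamental vector fields in frame coordinates. -/
theorem AdaptedChart.dframeCoord_fundamental {u : AdaptedFrame P} (hu : u.base ∈ c.top.source)
    (v : (Rn n →L[ℝ] Rn n) × (Rn n →L[ℝ] Rn k) × (Rn k →L[ℝ] Rn k)) :
    c.dframeCoord u (fundamental v u) =
      (0, (c.frameCoord u).2.1 ∘L v.1,
        (c.frameCoord u).2.2.1 ∘L v.1 + (c.frameCoord u).2.2.2 ∘L v.2.1,
        (c.frameCoord u).2.2.2 ∘L v.2.2) := by
  -- Smoothness of the curve itself is needed: `fundamental` is an `mfderiv`, whose default value is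
  -- `0` where the map is not differentiable.
  have h0 : ContMDiffAt 𝓘(ℝ, ℝ) 𝓘(ℝ, FrameModel n k) ∞ (u.expCurve v) 0 :=
    c.contMDiffAt_of_frameCoord (Filter.Eventually.of_forall fun _ => hu)
      (c.contDiff_frameCoord_expCurve hu v).contMDiff.contMDiffAt
  have h1 := (h0.mdifferentiableAt (by simp)).hasMFDerivAt
  have h2 := c.hasMFDerivAt_frameCoord hu
  rw [← u.expCurve_zero v] at h2
  have h3 := h2.comp (0 : ℝ) h1
  have h4 := hasMFDerivAt_unique h3
    (c.hasDerivAt_frameCoord_expCurve hu v).hasFDerivAt.hasMFDerivAt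
  have h5 := DFunLike.congr_fun h4 (1 : ℝ)
  rw [lowerBlock_comp, blocks_lowerBlock] at h5
  -- `u.expCurve v 0` equals `u` only propositionally, so the differential is transported from one
  -- base point to the other.
  have h6 : c.dframeCoord (u.expCurve v 0) = c.dframeCoord u := by rw [u.expCurve_zero v]
  refine (DFunLike.congr_fun h6.symm (fundamental v u)).trans (h5.trans ?_)
  exact one_smul ℝ _

/-- The vertical lift in jet coordinates. -/
theorem AdaptedChart.djetCoord_verticalLift {j : Jet P} (hj : j.base ∈ c.top.source)
    (ξ : TangentSpace 𝓘(ℝ, Rn n × Rn k) j.base) (hξ : P.dproj j.base ξ = 0)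
    (η : Rn n →L[ℝ] ℝ) :
    c.djetCoord j (j.verticalLift ξ hξ η) =
      (0, ContinuousLinearMap.smulRight
        (η ∘L (show Rn n →L[ℝ] Rn n from (c.dbot (P.proj j.base)).inverse))
        (c.dtop j.base ξ).2) := by
  let D : Rn n →L[ℝ] Rn n := (c.dbot (P.proj j.base)).inverse
  let A : (Rn n →L[ℝ] ℝ) →L[ℝ] (Rn n →L[ℝ] Rn k) :=
    ((ContinuousLinearMap.smulRightL ℝ (Rn n) (Rn k)).flip (c.dtop j.base ξ).2) ∘L
      ((ContinuousLinearMap.compL ℝ (Rn n) (Rn n) ℝ).flip D)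
  let A' : (Rn n →L[ℝ] ℝ) →L[ℝ] JetModel n k :=
    (ContinuousLinearMap.inr ℝ (Rn n × Rn k) (Rn n →L[ℝ] Rn k)) ∘L A
  -- In jet coordinates `η ↦ τ + η ⊗ ξ` is affine with linear part `A'`, so its derivative is `A'`.
  have h0 : c.jetCoord ∘ (fun η : Rn n →L[ℝ] ℝ => j.translate ξ hξ η) =
      fun η => c.jetCoord j + A' η := by
    funext η
    refine Prod.ext ?_ ?_
    · exact (add_zero (c.top j.base)).symm
    · refine ContinuousLinearMap.ext fun x => ?_
      change (c.dtop j.base (j.τ (D x) + η (D x) • ξ)).2 =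
        (c.dtop j.base (j.τ (D x))).2 + η (D x) • (c.dtop j.base ξ).2
      rw [map_add, map_smul]
      rfl
  have h1 : HasFDerivAt (fun η => c.jetCoord j + A' η) A' 0 := A'.hasFDerivAt.const_add _
  have h2 : ContDiff ℝ ∞ (fun η => c.jetCoord j + A' η) := contDiff_const.add A'.contDiff
  rw [← h0] at h1 h2
  have h3 : ContMDiffAt 𝓘(ℝ, Rn n →L[ℝ] ℝ) 𝓘(ℝ, JetModel n k) ∞
      (fun η : Rn n →L[ℝ] ℝ => j.translate ξ hξ η) 0 :=
    c.contMDiffAt_of_jetCoord (Filter.Eventually.of_forall fun _ => hj) h2.contMDiff.contMDiffAt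
  have h4 := (h3.mdifferentiableAt (by simp)).hasMFDerivAt
  have h5 := c.hasMFDerivAt_jetCoord hj
  rw [← j.translate_zero ξ hξ] at h5
  have h6 := hasMFDerivAt_unique (h5.comp (0 : Rn n →L[ℝ] ℝ) h4) h1.hasMFDerivAt
  have h7 : c.djetCoord (j.translate ξ hξ 0) = c.djetCoord j := by rw [j.translate_zero ξ hξ]
  exact (DFunLike.congr_fun h7.symm (j.verticalLift ξ hξ η)).trans (DFunLike.congr_fun h6 η)

/-! ### Intertwining of the tensors `S_ω` under `ρ` -/

theorem eq_sum_single {a : ℕ} (x : Rn a) : x = ∑ i, x i • EuclideanSpace.single i (1 : ℝ) := by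
  ext j
  simp [Finset.sum_apply, Pi.single_apply]

/-- This collapses the double sum over `i` and `C` defining `S̃_α` into a single rank one map, the
form in which the vertical lift also appears. -/
theorem sum_elementary {a b : ℕ} (f : Rn a →ₗ[ℝ] ℝ) (ζ : Rn b) :
    ∑ i, ∑ C, (f (EuclideanSpace.single i 1) * ζ C) • elementary i C =
      (LinearMap.toContinuousLinearMap f).smulRight ζ := by
  ext y C'
  have h : f y = ∑ i, y i * f (EuclideanSpace.single i 1) := by
    conv_lhs => rw [eq_sum_single y]
    simp
  simp only [ContinuousLinearMap.smulRight_apply, LinearMap.coe_toContinuousLinearMap', h]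
  simp [elementary, Finset.sum_apply, Pi.single_apply,
    Finset.sum_mul]
  exact Finset.sum_congr rfl fun i _ => by ring

theorem eq_sum_elementary {a b : ℕ} (ξ : Rn a →L[ℝ] Rn b) :
    ξ = ∑ i, ∑ C, (ξ (EuclideanSpace.single i 1)) C • elementary i C := by
  ext y C'
  conv_lhs => rw [eq_sum_single y]
  simp [elementary, Finset.sum_apply, Pi.single_apply]
  exact Finset.sum_congr rfl fun i _ => by ring

theorem AdaptedFrame.toMap_solder (u : AdaptedFrame P)
    (X : TangentSpace 𝓘(ℝ, FrameModel n k) u) : u.toMap (u.solder X) = u.dbase X :=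
  (LinearEquiv.ofBijective u.toMap.toLinearMap u.bijective).apply_symm_apply (u.dbase X)

/-- Split `λ_* X = θⁱ e_i + θᴬ e_A`. The second part is vertical, so `π_*` kills it, and `τ ∘ π_*`
fixes each `e_i`. Subtracting leaves `θᴬ e_A`. -/
theorem contactForm_drho (u : AdaptedFrame P) (X : TangentSpace 𝓘(ℝ, FrameModel n k) u) :
    (rho u).contactForm (drho u X) = u.toMap (0, (u.solder X).2) := by
  have h1 : u.dbase X = u.toMap ((u.solder X).1, 0) + u.toMap (0, (u.solder X).2) := by
    rw [← u.toMap_solder X, ← map_add]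
    simp
  have h2 : P.dproj u.base (u.dbase X) = P.dproj u.base (u.toMap ((u.solder X).1, 0)) := by
    rw [h1, map_add, u.vertical, add_zero]
  have h3 := rho_τ u (u.solder X).1
  rw [← h2] at h3
  change (rho u).dbase (drho u X) -
    (rho u).τ (P.dproj u.base ((rho u).dbase (drho u X))) = _
  rw [dbase_drho]
  refine (congrArg (fun z => u.dbase X - z) h3).trans ?_
  rw [h1]
  exact add_sub_cancel_left _ _

/-- The family `B` enters only through `λ_*(B_i) = e_i`, which gives `α(B_i) = α(π_* e_i)`. Each
`E*ⁱ_C` contributes `d` composed with an elementary matrix in the `b` slot. -/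
theorem AdaptedChart.dframeCoord_S {u : AdaptedFrame P} (hu : u.base ∈ c.top.source)
    {B : Fin n → ∀ u : AdaptedFrame P, TangentSpace 𝓘(ℝ, FrameModel n k) u}
    (hB : IsStandardFamily B) (α : Module.Dual ℝ (TangentSpace 𝓘(ℝ, Rn n) u.proj))
    (X : TangentSpace 𝓘(ℝ, FrameModel n k) u) :
    c.dframeCoord u (u.S B α X) = (0, 0, (c.frameCoord u).2.2.2 ∘L
      (LinearMap.toContinuousLinearMap (α ∘ₗ u.horizontal.toLinearMap)).smulRight
        (u.solder X).2, 0) := by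
  let T : (Rn n →L[ℝ] Rn k) →ₗ[ℝ] FrameModel n k :=
    { toFun := fun β => (0, 0, (c.frameCoord u).2.2.2 ∘L β, 0)
      map_add' := fun x y => by simp
      map_smul' := fun r x => by
        refine Prod.ext (smul_zero (A := Rn n × Rn k) r).symm (Prod.ext (clm_smul_zero r).symm
          (Prod.ext ?_ (clm_smul_zero r).symm))
        exact ContinuousLinearMap.comp_smul (c.frameCoord u).2.2.2 r x }
  have hE : ∀ i C, c.dframeCoord u (Ehv i C u) = T (elementary i C) := by
    intro i C
    refine (c.dframeCoord_fundamental hu _).trans ?_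
    simp [T]
  have hr : ∀ i, α (u.dproj (B i u)) =
      (α ∘ₗ u.horizontal.toLinearMap) (EuclideanSpace.single i 1) := by
    intro i
    rw [u.dproj_eq, hB i u]
    rfl
  have hS : u.S B α X = ∑ i, ∑ C, ((α ∘ₗ u.horizontal.toLinearMap) (EuclideanSpace.single i 1) *
      (u.solder X).2 C) • Ehv i C u := by
    change (∑ i, ∑ C, (α (u.dproj (B i u)) * (u.solder X).2 C) • Ehv i C u) = _
    simp only [hr]
  change _ = T _
  rw [hS, ← sum_elementary, map_sum, map_sum]
  refine Finset.sum_congr rfl fun i _ => ?_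
  rw [map_sum, map_sum]
  refine Finset.sum_congr rfl fun C _ => ?_
  rw [map_smul, map_smul, hE]

/-- In jet coordinates both sides have zero base component, and their slope is a covector tensored
with the same vector `d θ`. The covectors are `α` after `horizontal ∘ a⁻¹` and `α` after the inverse
of the differential of the base chart, which agree by `dbot_horizontal`. -/
theorem drho_S {B : Fin n → ∀ u : AdaptedFrame P, TangentSpace 𝓘(ℝ, FrameModel n k) u}
    (hB : IsStandardFamily B) (u : AdaptedFrame P)
    (α : Module.Dual ℝ (TangentSpace 𝓘(ℝ, Rn n) u.proj))
    (X : TangentSpace 𝓘(ℝ, FrameModel n k) u) :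
    drho u (u.S B α X) = (rho u).S α (drho u X) := by
  have hu := mem_adaptedChartAt P u.base
  set c := adaptedChartAt P u.base
  have ha := (c.frameCoord_mem hu).1
  apply c.djetCoord_injective (j := rho u) hu
  rw [c.djetCoord_drho hu, c.dframeCoord_S hu hB, fderiv_jetOfFrame ha]
  refine Eq.trans ?_ (c.djetCoord_verticalLift (j := rho u) hu _ _ _).symm
  refine Prod.ext rfl ?_
  refine ContinuousLinearMap.ext fun w => ?_
  -- Writing the argument as `a y` makes both inverses cancel: `a⁻¹` returns `y`, and the inverse
  -- base differential returns `u.horizontal y`.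
  obtain ⟨y, rfl⟩ : ∃ y, (c.frameCoord u).2.1 y = w :=
    ((isUnit_iff_bijective _).1 ha).2 w
  have h1 : Ring.inverse (c.frameCoord u).2.1 ((c.frameCoord u).2.1 y) = y :=
    DFunLike.congr_fun (Ring.inverse_mul_cancel _ ha) y
  have h2 : (c.dbot (P.proj u.base)).inverse ((c.frameCoord u).2.1 y) = u.horizontal y := by
    rw [← c.dbot_horizontal hu, (c.dbot_isInvertible (c.maps _ hu)).inverse_apply_self]
  have h3 : (c.dtop u.base ((rho u).contactForm (drho u X))).2 =
      (c.frameCoord u).2.2.2 (u.solder X).2 := by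
    refine (congrArg (fun z => (c.dtop u.base z).2) (contactForm_drho u X)).trans ?_
    rw [c.dtop_toMap hu]
    simp
  change (c.frameCoord u).2.2.2 (α (u.horizontal (Ring.inverse (c.frameCoord u).2.1
    ((c.frameCoord u).2.1 y))) • (u.solder X).2) =
    α ((c.dbot (P.proj u.base)).inverse ((c.frameCoord u).2.1 y)) •
      (c.dtop u.base ((rho u).contactForm (drho u X))).2
  rw [h1, h2, h3, map_smul]

/-- Vectors of `T_{π(e)} M` are separated by covectors `α`, and testing against `α` turns the claim
into `σ` applied to `drho_S`. -/
theorem alongForm_drho {B : Fin n → ∀ u : AdaptedFrame P, TangentSpace 𝓘(ℝ, FrameModel n k) u}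
    (hB : IsStandardFamily B) (u : AdaptedFrame P) (X : TangentSpace 𝓘(ℝ, FrameModel n k) u)
    (σ : Module.Dual ℝ (TangentSpace 𝓘(ℝ, JetModel n k) (rho u))) :
    alongForm (u.S B) X (σ ∘ₗ (drho u).toLinearMap) =
      alongForm (rho u).S (drho u X) σ := by
  apply (Module.evalEquiv ℝ (TangentSpace 𝓘(ℝ, Rn n) u.proj)).injective
  refine LinearMap.ext fun α => ?_
  refine (apply_alongForm (u.S B) X (σ ∘ₗ (drho u).toLinearMap) α).trans ?_
  refine Eq.trans ?_ (apply_alongForm (rho u).S (drho u X) σ α).symm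
  exact congrArg σ (drho_S hB u α X)

/-- Test against an arbitrary covector `σ` at `ρ(u)`. The defining sums then agree term by term,
since `ρ` is compatible with the projections to `M` and with the vectors `Sσ`. -/
theorem drho_Somega {B : Fin n → ∀ u : AdaptedFrame P, TangentSpace 𝓘(ℝ, FrameModel n k) u}
    (hB : IsStandardFamily B) (vol : ∀ x : M, TangentSpace 𝓘(ℝ, Rn n) x [⋀^Fin n]→ₗ[ℝ] ℝ)
    (u : AdaptedFrame P) (X : Fin n → TangentSpace 𝓘(ℝ, FrameModel n k) u) :
    drho u (u.Somega B vol X) = (rho u).Somega vol (fun i => drho u (X i)) := by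
  apply (Module.evalEquiv ℝ (TangentSpace 𝓘(ℝ, JetModel n k) (rho u))).injective
  refine LinearMap.ext fun σ => ?_
  refine (apply_volumeTensor u.dproj.toLinearMap (u.S B) (vol u.proj) X
    (σ ∘ₗ (drho u).toLinearMap)).trans ?_
  refine Eq.trans ?_ (apply_volumeTensor (rho u).dproj.toLinearMap (rho u).S (vol u.proj)
    (fun i => drho u (X i)) σ).symm
  refine Finset.sum_congr rfl fun i _ => congrArg (vol u.proj) ?_
  have h : (fun l => u.dproj.toLinearMap (X l)) =
      fun l => (rho u).dproj.toLinearMap (drho u (X l)) :=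
    funext fun l => (dproj_drho u (X l)).symm
  rw [alongForm_drho hB u (X i) σ, h]
  rfl

/-- If `ρ^*ℒ = L` near `u`, then `ρ^*Θ_ℒ = θ_L` at `u`. -/
theorem rhoPullback_chpForm {B : Fin n → ∀ u : AdaptedFrame P, TangentSpace 𝓘(ℝ, FrameModel n k) u}
    (hB : IsStandardFamily B) (vol : ∀ x : M, TangentSpace 𝓘(ℝ, Rn n) x [⋀^Fin n]→ₗ[ℝ] ℝ)
    {ℒ : Jet P → ℝ} {L : AdaptedFrame P → ℝ} {u : AdaptedFrame P}
    (hℒ : MDifferentiableAt 𝓘(ℝ, JetModel n k) 𝓘(ℝ, ℝ) ℒ (rho u))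
    (h : ∀ᶠ u' in 𝓝 u, ℒ (rho u') = L u') :
    rhoPullback (chpForm vol ℒ) u = frameForm B vol L u := by
  funext X
  have h1 : HasMFDerivAt 𝓘(ℝ, FrameModel n k) 𝓘(ℝ, ℝ) (ℒ ∘ rho) u
      ((Jet.d ℒ (rho u)).comp (drho u)) := hℒ.hasMFDerivAt.comp u (hasMFDerivAt_rho u)
  have h2 := (h1.congr_of_eventuallyEq (h.mono fun _ h' => h'.symm)).mfderiv
  have h3 : AdaptedFrame.d L u (u.Somega B vol X) =
      Jet.d ℒ (rho u) ((rho u).Somega vol (fun i => drho u (X i))) := by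
    rw [← drho_Somega hB]
    exact DFunLike.congr_fun h2 _
  change ℒ (rho u) * vol u.proj (fun i => (rho u).dproj (drho u (X i))) + _ = _
  rw [frameForm, h3, h.self_of_nhds]
  simp only [dproj_drho]

/-! ### Local sections of `ρ` -/

/-- The section `(z, p) ↦ (z, a, p a, d)` of `ρ` in jet and frame coordinates. -/
def frameOfJet (a : Rn n →L[ℝ] Rn n) (d : Rn k →L[ℝ] Rn k) (w : JetModel n k) : FrameModel n k :=
  (w.1, a, w.2 ∘L a, d)

theorem jetOfFrame_frameOfJet {a : Rn n →L[ℝ] Rn n} (ha : IsUnit a) (d : Rn k →L[ℝ] Rn k)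
    (w : JetModel n k) : jetOfFrame (frameOfJet a d w) = w := by
  refine Prod.ext rfl ?_
  change (w.2 ∘L a) ∘L Ring.inverse a = w.2
  have h : a ∘L Ring.inverse a = ContinuousLinearMap.id ℝ (Rn n) := Ring.mul_inverse_cancel _ ha
  rw [ContinuousLinearMap.comp_assoc, h, ContinuousLinearMap.comp_id]

theorem frameOfJet_jetOfFrame {w : FrameModel n k} (hw : IsUnit w.2.1) :
    frameOfJet w.2.1 w.2.2.2 (jetOfFrame w) = w := by
  have h : Ring.inverse w.2.1 ∘L w.2.1 = ContinuousLinearMap.id ℝ (Rn n) :=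
    Ring.inverse_mul_cancel _ hw
  have h2 : (w.2.2.1 ∘L Ring.inverse w.2.1) ∘L w.2.1 = w.2.2.1 := by
    rw [ContinuousLinearMap.comp_assoc, h, ContinuousLinearMap.comp_id]
  exact Prod.ext rfl (Prod.ext rfl (Prod.ext h2 rfl))

theorem contDiff_frameOfJet (a : Rn n →L[ℝ] Rn n) (d : Rn k →L[ℝ] Rn k) :
    ContDiff ℝ ∞ (frameOfJet a d : JetModel n k → FrameModel n k) :=
  contDiff_fst.prodMk (contDiff_const.prodMk
    ((contDiff_snd.clm_comp contDiff_const).prodMk contDiff_const))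

theorem AdaptedChart.rho_eq_of_frameCoord_eq {j : Jet P} (hj : j.base ∈ c.top.source)
    {u : AdaptedFrame P} (hu : u.base ∈ c.top.source) {a : Rn n →L[ℝ] Rn n} (ha : IsUnit a)
    {d : Rn k →L[ℝ] Rn k} (h : c.frameCoord u = frameOfJet a d (c.jetCoord j)) : rho u = j := by
  apply c.jetCoord_bijOn.injOn (show (rho u).base ∈ c.top.source from hu) hj
  rw [c.jetCoord_rho hu, h, jetOfFrame_frameOfJet ha]

/-- Any invertible diagonal blocks give a frame over a given jet; identity blocks are taken here. -/
theorem rho_surjective : Function.Surjective (rho : AdaptedFrame P → Jet P) := by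
  intro j
  have hj := mem_adaptedChartAt P j.base
  set c := adaptedChartAt P j.base
  obtain ⟨u, hu, h⟩ := c.frameCoord_bijOn.surjOn
    (show frameOfJet 1 1 (c.jetCoord j) ∈ c.top.target ×ˢ frameUnits n k from
      ⟨c.top.map_source hj, isUnit_one, isUnit_one⟩)
  exact ⟨u, c.rho_eq_of_frameCoord_eq hj hu isUnit_one h⟩

/-- The frame over the jet `j` with diagonal blocks `a` and `d` in the coordinates `c` (`u₀` only
serves to fill in values outside of the domain). -/
def AdaptedChart.frameOver (u₀ : AdaptedFrame P) (a : Rn n →L[ℝ] Rn n) (d : Rn k →L[ℝ] Rn k)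
    (j : Jet P) : AdaptedFrame P :=
  (c.frameHomeo u₀).symm (frameOfJet a d (c.jetCoord j))

section frameOver

variable {c} (u₀ : AdaptedFrame P) {a : Rn n →L[ℝ] Rn n} {d : Rn k →L[ℝ] Rn k} {j : Jet P}

theorem AdaptedChart.frameOver_mem (hj : j.base ∈ c.top.source) (ha : IsUnit a) (hd : IsUnit d) :
    (c.frameOver u₀ a d j).base ∈ c.top.source :=
  (c.frameHomeo u₀).map_target (show frameOfJet a d (c.jetCoord j) ∈ (c.frameHomeo u₀).target from
    ⟨c.top.map_source hj, ha, hd⟩)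

theorem AdaptedChart.frameCoord_frameOver (hj : j.base ∈ c.top.source) (ha : IsUnit a)
    (hd : IsUnit d) : c.frameCoord (c.frameOver u₀ a d j) = frameOfJet a d (c.jetCoord j) :=
  (c.frameHomeo u₀).right_inv (show frameOfJet a d (c.jetCoord j) ∈ (c.frameHomeo u₀).target from
    ⟨c.top.map_source hj, ha, hd⟩)

theorem AdaptedChart.rho_frameOver (hj : j.base ∈ c.top.source) (ha : IsUnit a) (hd : IsUnit d) :
    rho (c.frameOver u₀ a d j) = j :=
  c.rho_eq_of_frameCoord_eq hj (c.frameOver_mem u₀ hj ha hd) ha (c.frameCoord_frameOver u₀ hj ha hd)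

/-- A frame is recovered from its jet and its diagonal blocks, so `(a, d)` are coordinates on the
fibres of `ρ`. -/
theorem AdaptedChart.frameOver_rho {u : AdaptedFrame P} (hu : u.base ∈ c.top.source) :
    c.frameOver u₀ (c.frameCoord u).2.1 (c.frameCoord u).2.2.2 (rho u) = u := by
  rw [frameOver, c.jetCoord_rho hu, frameOfJet_jetOfFrame (c.frameCoord_mem hu).1]
  exact (c.frameHomeo u₀).left_inv hu

theorem AdaptedChart.contMDiffAt_frameOver (hj : j.base ∈ c.top.source) (ha : IsUnit a)
    (hd : IsUnit d) : ContMDiffAt 𝓘(ℝ, JetModel n k) 𝓘(ℝ, FrameModel n k) ∞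
      (c.frameOver u₀ a d) j := by
  refine c.contMDiffAt_of_frameCoord ?_ ?_
  · filter_upwards [c.isOpen_jet_source.mem_nhds hj] with j' hj'
    exact c.frameOver_mem u₀ hj' ha hd
  · refine ((contDiff_frameOfJet a d).contMDiff.contMDiffAt.comp j
      (c.contMDiffAt_jetCoord hj)).congr_of_eventuallyEq ?_
    filter_upwards [c.isOpen_jet_source.mem_nhds hj] with j' hj'
    exact c.frameCoord_frameOver u₀ hj' ha hd

end frameOver

/-- A function on `J¹π` whose pull-back along `ρ` is smooth is smooth. -/
theorem contMDiff_of_comp_rho {ℒ : Jet P → ℝ} {L : AdaptedFrame P → ℝ}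
    (hL : ContMDiff 𝓘(ℝ, FrameModel n k) 𝓘(ℝ, ℝ) ∞ L) (h : ∀ u, ℒ (rho u) = L u) :
    ContMDiff 𝓘(ℝ, JetModel n k) 𝓘(ℝ, ℝ) ∞ ℒ := by
  intro j
  -- Some frame is needed only as the filler point of the frame chart.
  obtain ⟨u₀, -⟩ := rho_surjective j
  have hj := mem_adaptedChartAt P j.base
  set c := adaptedChartAt P j.base
  have h1 : ContMDiffAt 𝓘(ℝ, JetModel n k) 𝓘(ℝ, ℝ) ∞ (L ∘ c.frameOver u₀ 1 1) j :=
    hL.contMDiffAt.comp j (AdaptedChart.contMDiffAt_frameOver u₀ hj isUnit_one isUnit_one)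
  refine h1.congr_of_eventuallyEq ?_
  filter_upwards [c.isOpen_jet_source.mem_nhds hj] with j' hj'
  rw [Function.comp_apply, ← h, AdaptedChart.rho_frameOver u₀ hj' isUnit_one isUnit_one]

/-! ### Lifted Lagrangians along the fibres of `ρ` -/

/-- Fundamental vector fields as a linear function of the Lie algebra element. -/
def fundamentalL (u : AdaptedFrame P) :
    ((Rn n →L[ℝ] Rn n) × (Rn n →L[ℝ] Rn k) × (Rn k →L[ℝ] Rn k)) →ₗ[ℝ]
      TangentSpace 𝓘(ℝ, FrameModel n k) u where
  toFun v := fundamental v u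
  map_add' v w := by
    have hu := mem_adaptedChartAt P u.base
    set c := adaptedChartAt P u.base
    apply c.dframeCoord_injective hu
    rw [map_add]
    simp only [c.dframeCoord_fundamental hu]
    refine Prod.ext (by simp) (Prod.ext (by simp) (Prod.ext ?_ (by simp)))
    simp only [Prod.snd_add, Prod.fst_add, ContinuousLinearMap.comp_add]
    abel
  map_smul' r v := by
    have hu := mem_adaptedChartAt P u.base
    set c := adaptedChartAt P u.base
    apply c.dframeCoord_injective hu
    rw [map_smul]
    simp only [c.dframeCoord_fundamental hu]
    refine Prod.ext (smul_zero (A := Rn n × Rn k) r).symm (Prod.ext ?_ (Prod.ext ?_ ?_))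
    · exact ContinuousLinearMap.comp_smul _ r v.1
    · refine ContinuousLinearMap.ext fun x => ?_
      simp
    · exact ContinuousLinearMap.comp_smul _ r v.2.2

/-- `ξ*(u)` is linear in `ξ`, and elementary matrices span each diagonal block. Vanishing on the
fields `E*ⁱ_j` and `E*ᴬ_B` therefore extends to all block diagonal `ξ`. -/
theorem IsLifted.d_fundamental {L : AdaptedFrame P → ℝ} (hlift : IsLifted L) (u : AdaptedFrame P)
    (ξ : Rn n →L[ℝ] Rn n) (ζ : Rn k →L[ℝ] Rn k) :
    AdaptedFrame.d L u (fundamental (ξ, 0, ζ) u) = 0 := by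
  let φ := (AdaptedFrame.d L u).toLinearMap ∘ₗ fundamentalL u
  let φ₁ := φ ∘ₗ LinearMap.inl ℝ _ _
  let φ₂ := φ ∘ₗ LinearMap.inr ℝ (Rn n →L[ℝ] Rn n) _ ∘ₗ LinearMap.inr ℝ (Rn n →L[ℝ] Rn k) _
  have h1 : φ₁ ξ = 0 := by
    rw [eq_sum_elementary ξ, map_sum]
    refine Finset.sum_eq_zero fun i _ => ?_
    rw [map_sum]
    refine Finset.sum_eq_zero fun j _ => ?_
    rw [map_smul]
    exact (congrArg (_ • ·) (hlift.1 i j u)).trans (smul_zero _)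
  have h2 : φ₂ ζ = 0 := by
    rw [eq_sum_elementary ζ, map_sum]
    refine Finset.sum_eq_zero fun i _ => ?_
    rw [map_sum]
    refine Finset.sum_eq_zero fun j _ => ?_
    rw [map_smul]
    exact (congrArg (_ • ·) (hlift.2 i j u)).trans (smul_zero _)
  have h3 : φ (ξ, 0, ζ) = φ₁ ξ + φ₂ ζ := by
    refine Eq.trans ?_ (map_add φ _ _)
    congr 1
    simp
  rw [h1, h2, add_zero] at h3
  exact h3

/-- A lifted Lagrangian has vanishing derivative along the fibres of `ρ`. -/
theorem IsLifted.hasFDerivAt_frameOver {L : AdaptedFrame P → ℝ} (hlift : IsLifted L)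
    (hL : ContMDiff 𝓘(ℝ, FrameModel n k) 𝓘(ℝ, ℝ) ∞ L) {j : Jet P} (hj : j.base ∈ c.top.source)
    (u₀ : AdaptedFrame P) {q : (Rn n →L[ℝ] Rn n) × (Rn k →L[ℝ] Rn k)} (ha : IsUnit q.1)
    (hd : IsUnit q.2) :
    HasFDerivAt (fun q : (Rn n →L[ℝ] Rn n) × (Rn k →L[ℝ] Rn k) => L (c.frameOver u₀ q.1 q.2 j))
      (0 : _ →L[ℝ] ℝ) q := by
  let g : (Rn n →L[ℝ] Rn n) × (Rn k →L[ℝ] Rn k) → AdaptedFrame P :=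
    fun q => c.frameOver u₀ q.1 q.2 j
  have hunits : ∀ᶠ q' in 𝓝 q, IsUnit q'.1 ∧ IsUnit q'.2 :=
    ((Units.isOpen.preimage continuous_fst).inter
      (Units.isOpen.preimage continuous_snd)).mem_nhds ⟨ha, hd⟩
  have hgc : c.frameCoord ∘ g =ᶠ[𝓝 q] fun q => frameOfJet q.1 q.2 (c.jetCoord j) :=
    hunits.mono fun q' hq' => AdaptedChart.frameCoord_frameOver u₀ hj hq'.1 hq'.2
  have hsmooth : ContDiff ℝ ∞ (fun q : (Rn n →L[ℝ] Rn n) × (Rn k →L[ℝ] Rn k) =>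
      (frameOfJet q.1 q.2 (c.jetCoord j) : FrameModel n k)) :=
    contDiff_const.prodMk (contDiff_fst.prodMk
      ((contDiff_const.clm_comp contDiff_fst).prodMk contDiff_snd))
  have hg : ContMDiffAt 𝓘(ℝ, (Rn n →L[ℝ] Rn n) × (Rn k →L[ℝ] Rn k)) 𝓘(ℝ, FrameModel n k) ∞ g q :=
    c.contMDiffAt_of_frameCoord
      (hunits.mono fun q' hq' => AdaptedChart.frameOver_mem u₀ hj hq'.1 hq'.2)
      (hsmooth.contMDiff.contMDiffAt.congr_of_eventuallyEq hgc)
  have hg' := (hg.mdifferentiableAt (by simp)).hasMFDerivAt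
  have hgu : (g q).base ∈ c.top.source := AdaptedChart.frameOver_mem u₀ hj ha hd
  have hcoord : c.frameCoord (g q) = frameOfJet q.1 q.2 (c.jetCoord j) := hgc.self_of_nhds
  let A : (Rn n →L[ℝ] Rn n) × (Rn k →L[ℝ] Rn k) →L[ℝ] (Rn n →L[ℝ] Rn k) :=
    (ContinuousLinearMap.compL ℝ (Rn n) (Rn n) (Rn k) (c.jetCoord j).2) ∘L
      ContinuousLinearMap.fst ℝ _ _
  have hA : HasFDerivAt (fun q : (Rn n →L[ℝ] Rn n) × (Rn k →L[ℝ] Rn k) =>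
      (c.jetCoord j).2 ∘L q.1) A q := A.hasFDerivAt
  have hD : HasFDerivAt (fun q : (Rn n →L[ℝ] Rn n) × (Rn k →L[ℝ] Rn k) =>
      (frameOfJet q.1 q.2 (c.jetCoord j) : FrameModel n k))
      ((0 : _ →L[ℝ] Rn n × Rn k).prod ((ContinuousLinearMap.fst ℝ _ _).prod
        (A.prod (ContinuousLinearMap.snd ℝ _ _)))) q :=
    (hasFDerivAt_const _ _).prodMk (hasFDerivAt_fst.prodMk (hA.prodMk hasFDerivAt_snd))
  have hchain := hasMFDerivAt_unique ((c.hasMFDerivAt_frameCoord hgu).comp q hg')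
    (hD.hasMFDerivAt.congr_of_eventuallyEq hgc)
  have hLg := ((hL.mdifferentiableAt (by simp) : MDifferentiableAt 𝓘(ℝ, FrameModel n k) 𝓘(ℝ, ℝ) L
    (g q)).hasMFDerivAt.comp q hg').hasFDerivAt
  refine hLg.congr_fderiv ?_
  refine ContinuousLinearMap.ext fun v => ?_
  have ha' : q.1 ∘L Ring.inverse q.1 = ContinuousLinearMap.id ℝ (Rn n) :=
    Ring.mul_inverse_cancel _ ha
  have hd' : q.2 ∘L Ring.inverse q.2 = ContinuousLinearMap.id ℝ (Rn k) :=
    Ring.mul_inverse_cancel _ hd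
  -- Over a fixed jet of slope `p` the frame is `(a, p a, d)`. A variation `(v₁, v₂)` of `(a, d)`
  -- moves the middle block by `p v₁ = b a⁻¹ v₁`, exactly as the infinitesimal right action of the
  -- block diagonal matrix `(a⁻¹ v₁, d⁻¹ v₂)` does.
  have hfund : mfderiv 𝓘(ℝ, (Rn n →L[ℝ] Rn n) × (Rn k →L[ℝ] Rn k)) 𝓘(ℝ, FrameModel n k) g q v =
      fundamental (Ring.inverse q.1 ∘L v.1, 0, Ring.inverse q.2 ∘L v.2) (g q) := by
    apply c.dframeCoord_injective hgu
    refine (DFunLike.congr_fun hchain v).trans ?_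
    rw [c.dframeCoord_fundamental hgu, hcoord]
    refine Prod.ext rfl (Prod.ext ?_ (Prod.ext ?_ ?_))
    · change v.1 = q.1 ∘L (Ring.inverse q.1 ∘L v.1)
      rw [← ContinuousLinearMap.comp_assoc, ha', ContinuousLinearMap.id_comp]
    · change (c.jetCoord j).2 ∘L v.1 = ((c.jetCoord j).2 ∘L q.1) ∘L (Ring.inverse q.1 ∘L v.1) +
        q.2 ∘L 0
      rw [ContinuousLinearMap.comp_zero, add_zero, ContinuousLinearMap.comp_assoc,
        ← ContinuousLinearMap.comp_assoc q.1, ha', ContinuousLinearMap.id_comp]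
    · change v.2 = q.2 ∘L (Ring.inverse q.2 ∘L v.2)
      rw [← ContinuousLinearMap.comp_assoc, hd', ContinuousLinearMap.id_comp]
  exact (congrArg (AdaptedFrame.d L (g q)) hfund).trans (hlift.d_fundamental (g q) _ _)

/-- A lifted Lagrangian is locally the pull-back of a smooth function along `ρ`. -/
theorem IsLifted.exists_local {L : AdaptedFrame P → ℝ} (hlift : IsLifted L)
    (hL : ContMDiff 𝓘(ℝ, FrameModel n k) 𝓘(ℝ, ℝ) ∞ L) (u₀ : AdaptedFrame P) :
    ∃ U : Set (AdaptedFrame P), IsOpen U ∧ u₀ ∈ U ∧ IsOpen (rho '' U) ∧ ∃ ℒ : Jet P → ℝ,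
      ContMDiffOn 𝓘(ℝ, JetModel n k) 𝓘(ℝ, ℝ) ∞ ℒ (rho '' U) ∧ ∀ u ∈ U, ℒ (rho u) = L u := by
  have hu₀ := mem_adaptedChartAt P u₀.base
  set c := adaptedChartAt P u₀.base
  let q₀ : (Rn n →L[ℝ] Rn n) × (Rn k →L[ℝ] Rn k) :=
    ((c.frameCoord u₀).2.1, (c.frameCoord u₀).2.2.2)
  have hunits : IsOpen {q : (Rn n →L[ℝ] Rn n) × (Rn k →L[ℝ] Rn k) | IsUnit q.1 ∧ IsUnit q.2} :=
    (Units.isOpen.preimage continuous_fst).inter (Units.isOpen.preimage continuous_snd)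
  -- A ball is connected, whereas the set of all invertible pairs `(a, d)` in general is not.
  obtain ⟨r, hr, hball⟩ := Metric.isOpen_iff.1 hunits q₀ (c.frameCoord_mem hu₀)
  have hq₀ := hball (Metric.mem_ball_self hr)
  let U : Set (AdaptedFrame P) := {u | u.base ∈ c.top.source} ∩
    c.frameCoord ⁻¹' ((fun w : FrameModel n k => (w.2.1, w.2.2.2)) ⁻¹' Metric.ball q₀ r)
  have hUopen : IsOpen U := by
    refine (c.frameHomeo u₀).isOpen_inter_preimage (Metric.isOpen_ball.preimage ?_)
    fun_prop
  -- The blocks do not constrain the jet: with blocks `q₀` there is a frame in `U` over every jet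
  -- based in the chart domain. So the image is open.
  have himage : rho '' U = {j | j.base ∈ c.top.source} := by
    ext j
    constructor
    · rintro ⟨u, hu, rfl⟩
      exact hu.1
    · intro hj
      refine ⟨c.frameOver u₀ q₀.1 q₀.2 j, ⟨AdaptedChart.frameOver_mem u₀ hj hq₀.1 hq₀.2, ?_⟩,
        AdaptedChart.rho_frameOver u₀ hj hq₀.1 hq₀.2⟩
      rw [Set.mem_preimage, AdaptedChart.frameCoord_frameOver u₀ hj hq₀.1 hq₀.2]
      exact Metric.mem_ball_self hr
  -- `ℒ` evaluates `L` on the section of `ρ` whose diagonal blocks are frozen at those of `u₀`.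
  refine ⟨U, hUopen, ⟨hu₀, Metric.mem_ball_self hr⟩, ?_, L ∘ c.frameOver u₀ q₀.1 q₀.2, ?_, ?_⟩
  · rw [himage]
    exact c.isOpen_jet_source
  · rw [himage]
    intro j hj
    exact (hL.contMDiffAt.comp j
      (AdaptedChart.contMDiffAt_frameOver u₀ hj hq₀.1 hq₀.2)).contMDiffWithinAt
  · intro u hu
    have hderiv : ∀ q ∈ Metric.ball q₀ r, HasFDerivAt (fun q => L (c.frameOver u₀ q.1 q.2 (rho u)))
        (0 : _ →L[ℝ] ℝ) q := fun q hq =>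
      hlift.hasFDerivAt_frameOver c hL (j := rho u) hu.1 u₀ (hball hq).1 (hball hq).2
    -- Both `u` and the frame over `ρ(u)` with blocks `q₀` lie on the piece of the fibre
    -- parametrised by the ball, where `L` has zero derivative.
    have hconst := Metric.isOpen_ball.is_const_of_fderiv_eq_zero
      (convex_ball q₀ r).isPreconnected
      (fun q hq => (hderiv q hq).differentiableAt.differentiableWithinAt)
      (fun q hq => (hderiv q hq).fderiv) (Metric.mem_ball_self hr) hu.2
    refine hconst.trans ?_
    exact congrArg L (AdaptedChart.frameOver_rho u₀ hu.1)

end FieldTheory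

end

/-! ### The proposition -/

theorem mainTheorem6 {n k : ℕ} {M E : Type*}
    [TopologicalSpace M] [ChartedSpace (FieldTheory.Rn n) M]
    [IsManifold 𝓘(ℝ, FieldTheory.Rn n) ∞ M]
    [TopologicalSpace E] [ChartedSpace (FieldTheory.Rn n × FieldTheory.Rn k) E]
    [IsManifold 𝓘(ℝ, FieldTheory.Rn n × FieldTheory.Rn k) ∞ E]
    (P : FieldTheory.FiberedManifold n k M E)
    (vol : ∀ x : M, TangentSpace 𝓘(ℝ, FieldTheory.Rn n) x [⋀^Fin n]→ₗ[ℝ] ℝ)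
    (B : Fin n → ∀ u : FieldTheory.AdaptedFrame P,
      TangentSpace 𝓘(ℝ, FieldTheory.FrameModel n k) u)
    (hB : FieldTheory.IsStandardFamily B)
    (L : FieldTheory.AdaptedFrame P → ℝ)
    (hL : ContMDiff 𝓘(ℝ, FieldTheory.FrameModel n k) 𝓘(ℝ, ℝ) ∞ L)
    (hlift : FieldTheory.IsLifted L) :
    (∀ ℒ : FieldTheory.Jet P → ℝ, (∀ u, ℒ (FieldTheory.rho u) = L u) →
      ContMDiff 𝓘(ℝ, FieldTheory.JetModel n k) 𝓘(ℝ, ℝ) ∞ ℒ ∧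
      FieldTheory.rhoPullback (FieldTheory.chpForm vol ℒ) = FieldTheory.frameForm B vol L) ∧
    ((∀ u u' : FieldTheory.AdaptedFrame P,
        FieldTheory.rho u = FieldTheory.rho u' → L u = L u') →
      ∃! ℒ : FieldTheory.Jet P → ℝ, ∀ u, ℒ (FieldTheory.rho u) = L u) ∧
    (∀ u₀ : FieldTheory.AdaptedFrame P, ∃ U : Set (FieldTheory.AdaptedFrame P),
      IsOpen U ∧ u₀ ∈ U ∧ IsOpen (FieldTheory.rho '' U) ∧ ∃ ℒ : FieldTheory.Jet P → ℝ,
        ContMDiffOn 𝓘(ℝ, FieldTheory.JetModel n k) 𝓘(ℝ, ℝ) ∞ ℒ (FieldTheory.rho '' U) ∧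
        (∀ u ∈ U, ℒ (FieldTheory.rho u) = L u) ∧
        ∀ u ∈ U, FieldTheory.rhoPullback (FieldTheory.chpForm vol ℒ) u =
          FieldTheory.frameForm B vol L u) := by
  refine ⟨fun ℒ hℒ => ?_, fun hfib => ?_, fun u₀ => ?_⟩
  · have hs := FieldTheory.contMDiff_of_comp_rho hL hℒ
    exact ⟨hs, funext fun u => FieldTheory.rhoPullback_chpForm hB vol
      (hs.mdifferentiableAt (by simp)) (Filter.Eventually.of_forall hℒ)⟩
  -- Evaluate `L` at any preimage of the jet; constancy on the fibres makes the choice immaterial,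
  -- and surjectivity of `ρ` forces uniqueness.
  · refine ⟨fun j => L (Function.surjInv FieldTheory.rho_surjective j), fun u => ?_, ?_⟩
    · exact hfib _ _ (Function.surjInv_eq FieldTheory.rho_surjective (FieldTheory.rho u))
    · intro ℒ hℒ
      funext j
      rw [← hℒ, Function.surjInv_eq FieldTheory.rho_surjective]
  · obtain ⟨U, hU, hu₀, hρU, ℒ, hsm, hℒ⟩ := hlift.exists_local hL u₀
    refine ⟨U, hU, hu₀, hρU, ℒ, hsm, hℒ, fun u hu => ?_⟩
    -- Openness of `ρ(U)` turns smoothness on the set into differentiability at `ρ(u)`, and openness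
    -- of `U` makes `ρ^*ℒ = L` hold near `u`.
    exact FieldTheory.rhoPullback_chpForm hB vol
      ((hsm.contMDiffAt (hρU.mem_nhds ⟨u, hu, rfl⟩)).mdifferentiableAt (by simp))
      (Filter.mem_of_superset (hU.mem_nhds hu) hℒ)
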